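/- For $t\in\mathbb C\setminus((-\infty,0]\cup[1,\infty))$ let $K(t)=\int_0^{\pi/2}(1-t\sin^2\varphi)^{-1/2}\,d\varphi$, $K'(t)=K(1-t)$, $\tau=\tau(t)=iK'(t)/K(t)$ and $q=e^{i\pi\tau}$ (principal branches), let $\theta_j(\cdot|\tau)$, $j=1,\dots,4$, be the Jacobi theta functions with quasi-periods $\pi,\pi\tau$, and let $\mathrm{sn},\mathrm{cn},\mathrm{dn}(u,t)$ be the Jacobi elliptic functions of parameter $t=k^2$. For $x,y\in\mathbb C$ put $z=\frac{2K(t)}{\pi}(x+\tau y)$ and let $$q_0(t)=t\,\frac{\mathrm{cn}^2(z,t)}{\mathrm{dn}^2(z,t)}$$ be the Picard solution of Painlevé VI with $\alpha=\beta=\gamma=0$, $\delta=\tfrac12$. Let $$H(t,q,p)=\frac{1}{t(t-1)}\Big[q(q-1)(q-t)p^2+q(q-1)p+\tfrac14(q-t)\Big]$$ be the corresponding Hamiltonian, and set $$H_0(t)=-\frac{1}{4(t-1)}-\frac{\mathrm{cn}^2(z,t)}{4t(t-1)\,\mathrm{sn}^2(z,t)}+\frac{\mathscr E(x,y,t)^2}{4t(t-1)},\qquad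 \mathscr E(x,y,t)=\frac{\pi}{2K(t)}\,\frac{\theta_1'(x+\tau y|\tau)}{\theta_1(x+\tau y|\tau)}+\frac{iy}{K(t)},$$ where $\theta_1'$ is the derivative of $\theta_1$ in its first argument. (a) Wherever $q_0(t)\notin\{0,1,t,\infty\}$, there is exactly one $p_0(t)$ with $q_0'(t)=\frac{\partial H}{\partial p}(t,q_0(t),p_0(t))$, and $H(t,q_0(t),p_0(t))=H_0(t)$. (b) Let $D$ be the set of $t$ for which $\mathrm{sn}(z,t)$ is finite and nonzero, and let $$T_0(t)=q^{y^2/\pi^2}\,t^{-1/4}\,\frac{\theta_1(x+\tau y|\tau)}{\theta_4(0|\tau)},\qquad q^{y^2/\pi^2}=e^{i\tau y^2/\pi}.$$ On $D$ the function $T_0$ is nonzero and $T_0'(t)=H_0(t)\,T_0(t)$. Locally on $D$ the function $H_0$ has antiderivatives, and for every connected open $U\subseteq D$ and every antiderivative $F=\int H_0\,dt$ of $H_0$ on $U$ there is a constant $c_0\neq0$ such that $$\exp\Big\{\int H_0(t)\,dt\Big\}=c_0\,q^{y^2/\pi^2}\,t^{-1/4}\,\frac{\theta_1(x+\tau y|\tau)}{\theta_4(0|\tau)}\qquad\text{on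 }U .$$ -/

import Mathlib

namespace PicardPVI

noncomputable section

/-- `θ₃(z|τ) = ∑_{n ∈ ℤ} q^{n²} e^{2inz}` with `q = e^{iπτ}` (quasi-periods `π`, `πτ`). -/
def theta3 (z τ : ℂ) : ℂ := jacobiTheta₂ (z / Real.pi) τ

/-- `θ₄(z|τ) = θ₃(z + π/2|τ) = ∑_{n ∈ ℤ} (-1)^n q^{n²} e^{2inz}`. -/
def theta4 (z τ : ℂ) : ℂ := jacobiTheta₂ (z / Real.pi + 1 / 2) τ

/-- `θ₂(z|τ) = q^{1/4} e^{iz} θ₃(z + πτ/2|τ) = 2 ∑_{n ≥ 0} q^{(n+1/2)²} cos((2n+1)z)`. -/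
def theta2 (z τ : ℂ) : ℂ :=
  Complex.exp (Complex.I * Real.pi * τ / 4 + Complex.I * z) *
    jacobiTheta₂ (z / Real.pi + τ / 2) τ

/-- `θ₁(z|τ) = -i q^{1/4} e^{iz} θ₄(z + πτ/2|τ) = 2 ∑_{n ≥ 0} (-1)^n q^{(n+1/2)²} sin((2n+1)z)`. -/
def theta1 (z τ : ℂ) : ℂ :=
  -Complex.I * Complex.exp (Complex.I * Real.pi * τ / 4 + Complex.I * z) *
    jacobiTheta₂ (z / Real.pi + τ / 2 + 1 / 2) τ

/-- The complete elliptic integral of the first kind of the parameter `t = k²`,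
`K(t) = ∫_0^{π/2} dφ / √(1 - t sin² φ)`, on its principal branch `t ∈ ℂ ∖ [1, ∞)`. -/
def ellipticK (t : ℂ) : ℂ :=
  ∫ φ in (0 : ℝ)..(Real.pi / 2), 1 / (1 - t * (Real.sin φ : ℂ) ^ 2) ^ (1 / 2 : ℂ)

/-- `τ(t) = i K'(t) / K(t)` with `K'(t) = K(1 - t)`. -/
def tau (t : ℂ) : ℂ := Complex.I * ellipticK (1 - t) / ellipticK t

/-- `ℂ ∖ ((-∞, 0] ∪ [1, ∞))`, where `K(t)`, `K(1 - t)` and `t^{-1/4}` are all on their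
principal branches. -/
def cutPlane : Set ℂ := {t | t ∈ Complex.slitPlane ∧ 1 - t ∈ Complex.slitPlane}

/-- The variable `v` with `u = (2K(t)/π) v`. -/
def thetaArg (u t : ℂ) : ℂ := Real.pi * u / (2 * ellipticK t)

/-- `sn(u, t) = k^{-1/2} θ₁(v|τ)/θ₄(v|τ)`, with `k^{1/2} = θ₂(0|τ)/θ₃(0|τ)`. -/
def sn (u t : ℂ) : ℂ :=
  theta3 0 (tau t) / theta2 0 (tau t) *
    (theta1 (thetaArg u t) (tau t) / theta4 (thetaArg u t) (tau t))

/-- `cn(u, t) = (k'/k)^{1/2} θ₂(v|τ)/θ₄(v|τ)`, with `k'^{1/2} = θ₄(0|τ)/θ₃(0|τ)`. -/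
def cn (u t : ℂ) : ℂ :=
  theta4 0 (tau t) / theta2 0 (tau t) *
    (theta2 (thetaArg u t) (tau t) / theta4 (thetaArg u t) (tau t))

/-- `dn(u, t) = k'^{1/2} θ₃(v|τ)/θ₄(v|τ)`. -/
def dn (u t : ℂ) : ℂ :=
  theta4 0 (tau t) / theta3 0 (tau t) *
    (theta3 (thetaArg u t) (tau t) / theta4 (thetaArg u t) (tau t))

/-- `z = (2K(t)/π)(x + τ y)`. -/
def zVar (x y t : ℂ) : ℂ := 2 * ellipticK t / Real.pi * (x + tau t * y)

/-- The Picard solution `q₀(t) = t cn²(z, t)/dn²(z, t)`. -/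
def picardQ (x y t : ℂ) : ℂ := t * (cn (zVar x y t) t ^ 2 / dn (zVar x y t) t ^ 2)

/-- Okamoto's Hamiltonian of Painlevé VI with parameters `b₁, b₂, b₃, b₄`. -/
def hamiltonianVI (b₁ b₂ b₃ b₄ t q p : ℂ) : ℂ :=
  let κ₀ := b₁ + b₂
  let κ₁ := b₁ - b₂
  let κinf := b₃ - b₄
  let θ := b₃ + b₄ + 1
  let κ := (κ₀ + κ₁ + θ - 1) ^ 2 / 4 - κinf ^ 2 / 4
  1 / (t * (t - 1)) *
    (q * (q - 1) * (q - t) * p ^ 2 -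
      (κ₀ * (q - 1) * (q - t) + κ₁ * q * (q - t) + (θ - 1) * q * (q - 1)) * p +
      κ * (q - t))

/-- The Hamiltonian for `b = (0, 0, -1/2, -1/2)`, that is `α = β = γ = 0`, `δ = 1/2`. -/
def picardHam (t q p : ℂ) : ℂ := hamiltonianVI 0 0 (-1 / 2) (-1 / 2) t q p

/-- `(π/(2K(t))) [log θ₁(x + τy|τ)]'_x + iy/K(t)`. -/
def scrE (x y t : ℂ) : ℂ :=
  Real.pi / (2 * ellipticK t) * logDeriv (fun s => theta1 s (tau t)) (x + tau t * y) +
    Complex.I * y / ellipticK t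

/-- The function `H₀(t)` in closed form. -/
def picardH0 (x y t : ℂ) : ℂ :=
  -(1 / (4 * (t - 1))) -
    cn (zVar x y t) t ^ 2 / (4 * t * (t - 1) * sn (zVar x y t) t ^ 2) +
    scrE x y t ^ 2 / (4 * t * (t - 1))

/-- `q^{y²/π²} t^{-1/4} θ₁(x + τy|τ)/θ₄(0|τ)`, where `q^{y²/π²} = e^{iπτ y²/π²}`. -/
def tauFn (x y t : ℂ) : ℂ :=
  Complex.exp (Complex.I * Real.pi * tau t * (y ^ 2 / (Real.pi : ℂ) ^ 2)) *
    t ^ (-(1 / 4) : ℂ) *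
    (theta1 (x + tau t * y) (tau t) / theta4 0 (tau t))

/-- The `t` in the cut plane at which `sn(z, t)` is finite and nonzero, so that the closed form
of `H₀(t)` makes sense. -/
def regularSet (x y : ℂ) : Set ℂ :=
  {t | t ∈ cutPlane ∧ theta1 (x + tau t * y) (tau t) ≠ 0 ∧ theta4 (x + tau t * y) (tau t) ≠ 0}

/-- The `t` in the cut plane at which none of the four theta functions vanishes at `x + τy`, that
is, at which `q₀(t)` differs from `0`, `1`, `t` and `∞`. -/
def genericSet (x y : ℂ) : Set ℂ :=
  {t | t ∈ regularSet x y ∧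
    theta2 (x + tau t * y) (tau t) ≠ 0 ∧ theta3 (x + tau t * y) (tau t) ≠ 0}

end

end PicardPVI

/-! Write `θⱼ` for theta constants, `Θⱼ` for theta functions at `ξ = x + τy`, and `τ'` for `dτ/dt`.
On the cut plane `t = θ₂⁴/θ₃⁴` and `K = (π/2) θ₃²`, so everything is a function of `τ` alone. The
heat equation `∂_τ θ = -(iπ/4) ∂_z² θ` then trades derivatives in `t` for derivatives in `z`.
Differentiating `t = θ₂⁴/θ₃⁴` in this way gives `1/(t(t-1)) = -iπ τ' θ₃⁴` (`exists_hasDerivAt_tau`,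
`deriv_tau_mul`).

For `T₀`, the heat equation produces `Θ₁''/Θ₁`, which the addition formula for `θ₁` rewrites as
`(Θ₁'/Θ₁)² + θ₄''/θ₄ - θ₂²θ₃²Θ₄²/Θ₁²`. The constant `θ₄''/θ₄` is cancelled by the denominator
`θ₄(0|τ)`. The square completes with the contributions of `dξ/dt = τ' y` and of `q^{y²/π²}` to the
square of `𝓔`. The last term is `cn²/sn² + 1` up to a factor (`hasDerivAt_tauFn`). Hence `exp(∫
H₀)/T₀` is locally constant.

For the Hamiltonian, `∂H/∂p` is affine in `p` with nonzero slope at generic points, so `p₀` is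
unique. The Wronskians of `θ₁, θ₄` and of `θ₂, θ₃` give `(t(t-1)q')² = 𝓔² q(q-1)(q-t)`, and with
theta quotients for `q - 1` and `q - t` the Hamiltonian collapses to `H₀` (`hasDerivAt_picardQ`,
`picard_hamiltonian`).

The theta identities all come from one product formula relating `τ` to `2τ` (`thetaChar_mul`).
Iterating `τ ↦ 2τ` to the cusp gives nonvanishing and Jacobi's `θ₁' = θ₂θ₃θ₄`. On `τ = iy` the same
doubling acts on `(θ₃², θ₄²)` as the arithmetic-geometric mean, which evaluates `K`. Since `Im τ(t)
> 0` on the cut plane, the identity theorem extends `t = θ₂⁴/θ₃⁴` and `K = (π/2) θ₃²` from the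
imaginary axis to the whole cut plane. -/

namespace PicardPVI

open Complex Filter Topology MeasureTheory Set
open scoped Real ComplexConjugate

/-! ### Theta functions with characteristics and their product formula -/

/-- The theta function with characteristics `a`, `b` and quasi-periods `π`, `πτ`. -/
noncomputable def thetaChar (a b z τ : ℂ) : ℂ :=
  cexp (I * π * τ * a ^ 2 + 2 * I * a * z) * jacobiTheta₂ (z / π + a * τ + b) τ

/-- The general term of the series of `thetaChar`. -/
noncomputable def thetaCharTerm (a b z τ : ℂ) (n : ℤ) : ℂ :=
  cexp (I * π * τ * (n + a) ^ 2 + 2 * I * (n + a) * z + 2 * π * I * n * b)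

lemma pi_ne_zero' : (π : ℂ) ≠ 0 := by exact_mod_cast Real.pi_ne_zero

lemma thetaCharTerm_eq (a b z τ : ℂ) (n : ℤ) :
    thetaCharTerm a b z τ n = cexp (I * π * τ * a ^ 2 + 2 * I * a * z) *
      jacobiTheta₂_term n (z / π + a * τ + b) τ := by
  have := pi_ne_zero'
  rw [thetaCharTerm, jacobiTheta₂_term, ← Complex.exp_add]
  congr 1
  field_simp
  ring

lemma hasSum_thetaChar (a b z : ℂ) {τ : ℂ} (hτ : 0 < τ.im) :
    HasSum (thetaCharTerm a b z τ) (thetaChar a b z τ) := by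
  simp_rw [funext (thetaCharTerm_eq a b z τ)]
  exact (hasSum_jacobiTheta₂_term _ hτ).mul_left _

/-- Pairs of integers are split by the parity of their sum. -/
def parityEquiv : (ℤ × ℤ) ⊕ (ℤ × ℤ) ≃ ℤ × ℤ where
  toFun := Sum.elim (fun p => (p.1 + p.2, p.1 - p.2)) (fun p => (p.1 + p.2 + 1, p.1 - p.2))
  invFun p := if (p.1 + p.2) % 2 = 0 then Sum.inl ((p.1 + p.2) / 2, (p.1 - p.2) / 2)
    else Sum.inr ((p.1 + p.2 - 1) / 2, (p.1 - p.2 - 1) / 2)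
  left_inv := by
    rintro (⟨k, l⟩ | ⟨k, l⟩)
    · have h : (k + l + (k - l)) % 2 = 0 := by omega
      simp only [Sum.elim_inl, h, if_true]
      congr 2 <;> omega
    · have h : ¬ (k + l + 1 + (k - l)) % 2 = 0 := by omega
      simp only [Sum.elim_inr, h, if_false]
      congr 2 <;> omega
  right_inv := by
    rintro ⟨n, m⟩
    by_cases h : (n + m) % 2 = 0
    · simp only [h, if_true, Sum.elim_inl, Prod.mk.injEq]
      omega
    · simp only [h, if_false, Sum.elim_inr, Prod.mk.injEq]
      omega

/-- In the double series put `n = k + l`, `m = k - l` when `n + m` is even and `n = k + l + 1`, `m =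
k - l` when it is odd. Since `n² + m² = 2(k² + l²)` in the first case, the quadratic form separates
again with `τ` replaced by `2τ`; in the second case the shift is absorbed in the characteristics. -/
theorem thetaChar_mul (a b a' b' u v : ℂ) {τ : ℂ} (hτ : 0 < τ.im) :
    thetaChar a b u τ * thetaChar a' b' v τ =
      thetaChar ((a + a') / 2) (b + b') (u + v) (2 * τ) *
        thetaChar ((a - a') / 2) (b - b') (u - v) (2 * τ) +
      cexp (2 * π * I * b) * (thetaChar ((a + a' + 1) / 2) (b + b') (u + v) (2 * τ) *
        thetaChar ((a - a' + 1) / 2) (b - b') (u - v) (2 * τ)) := by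
  have h2 : 0 < (2 * τ).im := by simpa using hτ
  have prod : ∀ (a b a' b' u v : ℂ) {τ : ℂ}, 0 < τ.im →
      HasSum (fun p : ℤ × ℤ => thetaCharTerm a b u τ p.1 * thetaCharTerm a' b' v τ p.2)
        (thetaChar a b u τ * thetaChar a' b' v τ) := by
    intro a b a' b' u v τ hτ
    have h1 := hasSum_thetaChar a b u hτ
    have h2 := hasSum_thetaChar a' b' v hτ
    have := (summable_mul_of_summable_norm h1.summable.norm h2.summable.norm).hasSum
    rwa [← tsum_mul_tsum_of_summable_norm h1.summable.norm h2.summable.norm, h1.tsum_eq,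
      h2.tsum_eq] at this
  have hL := (parityEquiv.hasSum_iff).mpr (prod a b a' b' u v hτ)
  refine hL.unique (HasSum.sum ?_ ?_)
  · convert prod ((a + a') / 2) (b + b') ((a - a') / 2) (b - b') (u + v) (u - v) h2 using 1
    funext p
    change thetaCharTerm a b u τ (p.1 + p.2) * thetaCharTerm a' b' v τ (p.1 - p.2) = _
    simp only [thetaCharTerm, ← Complex.exp_add]
    congr 1
    push_cast
    ring
  · refine ((prod ((a + a' + 1) / 2) (b + b') ((a - a' + 1) / 2) (b - b') (u + v) (u - v)
      h2).mul_left (cexp (2 * π * I * b))).congr_fun fun p => ?_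
    change thetaCharTerm a b u τ (p.1 + p.2 + 1) * thetaCharTerm a' b' v τ (p.1 - p.2) = _
    simp only [thetaCharTerm, ← Complex.exp_add]
    congr 1
    push_cast
    ring

lemma thetaChar_add_one_right (a b z τ : ℂ) : thetaChar a (b + 1) z τ = thetaChar a b z τ := by
  rw [thetaChar, thetaChar, ← add_assoc, jacobiTheta₂_add_left]

lemma thetaChar_add_one_left (a b z τ : ℂ) :
    thetaChar (a + 1) b z τ = cexp (-(2 * π * I * b)) * thetaChar a b z τ := by
  have := pi_ne_zero'
  rw [thetaChar, thetaChar, show z / π + (a + 1) * τ + b = (z / π + a * τ + b) + τ by ring,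
    jacobiTheta₂_add_left', ← mul_assoc, ← mul_assoc, ← Complex.exp_add, ← Complex.exp_add]
  congr 2
  field_simp
  ring

lemma thetaChar_neg (a b z τ : ℂ) : thetaChar (-a) (-b) (-z) τ = thetaChar a b z τ := by
  rw [thetaChar, thetaChar, ← jacobiTheta₂_neg_left]
  congr 2 <;> ring

lemma exp_pi_half : cexp (2 * π * I * (1 / 2)) = -1 := by
  rw [← exp_pi_mul_I]; congr 1; ring

lemma theta3_eq (z τ : ℂ) : theta3 z τ = thetaChar 0 0 z τ := by simp [theta3, thetaChar]

lemma theta4_eq (z τ : ℂ) : theta4 z τ = thetaChar 0 (1 / 2) z τ := by simp [theta4, thetaChar]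

lemma theta2_eq (z τ : ℂ) : theta2 z τ = thetaChar (1 / 2) 0 z τ := by
  rw [theta2, thetaChar]; congr 2 <;> ring

lemma theta1_eq (z τ : ℂ) : theta1 z τ = -I * thetaChar (1 / 2) (1 / 2) z τ := by
  rw [theta1, thetaChar, mul_assoc]; congr 3 <;> ring

/-! ### The heat equation and derivatives along paths -/

/-- Heat equation for `jacobiTheta₂`. -/
lemma hasDerivAt_jacobiTheta₂'_fst (z : ℂ) {τ : ℂ} (hτ : 0 < τ.im) :
    HasDerivAt (fun z => jacobiTheta₂' z τ) (4 * π * I * jacobiTheta₂_fderiv z τ (0, 1)) z := by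
  have hterm : ∀ n : ℤ, ∀ z, HasDerivAt (fun z => jacobiTheta₂'_term n z τ)
      (4 * π * I * jacobiTheta₂_term_fderiv n z τ (0, 1)) z := by
    intro n z
    have h1 : HasDerivAt (fun z : ℂ => 2 * π * I * n * z + π * I * n ^ 2 * τ)
        (2 * π * I * n) z := by
      simpa using ((hasDerivAt_id z).const_mul (2 * π * I * n : ℂ)).add_const (π * I * n ^ 2 * τ)
    refine (h1.cexp.const_mul (2 * π * I * n)).congr_deriv ?_
    simp [jacobiTheta₂_term_fderiv]
    ring
  -- On the strip `|Im u| < S` the differentiated series has a summable majorant, which permits one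
  -- more termwise derivative.
  obtain ⟨S, hz⟩ := exists_gt |z.im|
  have hVo : IsOpen {u : ℂ | |u.im| < S} :=
    (_root_.continuous_abs.comp continuous_im).isOpen_preimage _ isOpen_Iio
  have hu : Summable fun n : ℤ => 2 * π * |n| * rexp (-π * (τ.im * n ^ 2 - 2 * S * |n|)) := by
    have := (summable_pow_mul_jacobiTheta₂_term_bound S hτ 1).mul_left (2 * π)
    simpa [mul_assoc] using this
  have hb : ∀ (n : ℤ) (w : ℂ), w ∈ {u : ℂ | |u.im| < S} → ‖jacobiTheta₂'_term n w τ‖ ≤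
      2 * π * |n| * rexp (-π * (τ.im * n ^ 2 - 2 * S * |n|)) :=
    fun n w hw => norm_jacobiTheta₂'_term_le hτ (le_of_lt hw) le_rfl n
  have hd : ∀ n : ℤ, DifferentiableOn ℂ (fun z => jacobiTheta₂'_term n z τ)
      {u : ℂ | |u.im| < S} := fun n z _ => (hterm n z).differentiableAt.differentiableWithinAt
  have h1 := hasSum_deriv_of_summable_norm hu hd hVo hb hz
  have h2 := (differentiableOn_tsum_of_summable_norm hu hd hVo hb).differentiableAt
    (hVo.mem_nhds hz)
  have h3 : HasSum (fun n => 4 * π * I * jacobiTheta₂_term_fderiv n z τ (0, 1))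
      (4 * π * I * jacobiTheta₂_fderiv z τ (0, 1)) :=
    (((ContinuousLinearMap.apply ℂ ℂ ((0, 1) : ℂ × ℂ)).hasSum
      (hasSum_jacobiTheta₂_term_fderiv z hτ))).mul_left _
  have h4 := h1.unique (h3.congr_fun (fun n => (hterm n z).deriv))
  rw [← h4]
  exact h2.hasDerivAt

lemma jacobiTheta₂_fderiv_apply (z : ℂ) {τ : ℂ} (hτ : 0 < τ.im) (x y : ℂ) :
    jacobiTheta₂_fderiv z τ (x, y) =
      jacobiTheta₂' z τ * x + jacobiTheta₂_fderiv z τ (0, 1) * y := by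
  have h1 : HasDerivAt (jacobiTheta₂ · τ) (jacobiTheta₂_fderiv z τ (1, 0)) z := by
    exact ((hasFDerivAt_jacobiTheta₂ z hτ).comp (𝕜 := ℂ) z
      (hasFDerivAt_prodMk_left z τ)).hasDerivAt
  rw [← h1.unique (hasDerivAt_jacobiTheta₂_fst z hτ)]
  have : ((x, y) : ℂ × ℂ) = x • (1, 0) + y • (0, 1) := by simp
  rw [this, map_add, map_smul, map_smul, smul_eq_mul, smul_eq_mul]
  ring

lemma hasDerivAt_jacobiTheta₂_path {ξ T : ℂ → ℂ} {ξ' T' s : ℂ} (hτ : 0 < (T s).im)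
    (hξ : HasDerivAt ξ ξ' s) (hT : HasDerivAt T T' s) :
    HasDerivAt (fun s => jacobiTheta₂ (ξ s) (T s))
      (jacobiTheta₂' (ξ s) (T s) * ξ' + jacobiTheta₂_fderiv (ξ s) (T s) (0, 1) * T') s := by
  have := (hasFDerivAt_jacobiTheta₂ (ξ s) hτ).comp_hasDerivAt s (hξ.prodMk hT)
  rwa [jacobiTheta₂_fderiv_apply _ hτ] at this

/-- The first derivative of `thetaChar` in its argument. -/
noncomputable def thetaCharDeriv (a b z τ : ℂ) : ℂ :=
  cexp (I * π * τ * a ^ 2 + 2 * I * a * z) *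
    (2 * I * a * jacobiTheta₂ (z / π + a * τ + b) τ + jacobiTheta₂' (z / π + a * τ + b) τ / π)

/-- The second derivative of `thetaChar` in its argument. -/
noncomputable def thetaCharDeriv2 (a b z τ : ℂ) : ℂ :=
  cexp (I * π * τ * a ^ 2 + 2 * I * a * z) *
    (-4 * a ^ 2 * jacobiTheta₂ (z / π + a * τ + b) τ +
      4 * I * a * jacobiTheta₂' (z / π + a * τ + b) τ / π +
      4 * I * jacobiTheta₂_fderiv (z / π + a * τ + b) τ (0, 1) / π)

/-- Chain rule combined with the heat equation: the `τ`-derivative enters only as `-(iπ/4)` times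
the second `z`-derivative. -/
lemma hasDerivAt_thetaChar_path (a b : ℂ) {ξ T : ℂ → ℂ} {ξ' T' s : ℂ} (hτ : 0 < (T s).im)
    (hξ : HasDerivAt ξ ξ' s) (hT : HasDerivAt T T' s) :
    HasDerivAt (fun s => thetaChar a b (ξ s) (T s))
      (thetaCharDeriv a b (ξ s) (T s) * ξ' +
        -(I * π / 4) * thetaCharDeriv2 a b (ξ s) (T s) * T') s := by
  have hπ := pi_ne_zero'
  have h1 := (((hT.const_mul (I * π)).mul_const (a ^ 2)).add (hξ.const_mul (2 * I * a))).cexp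
  have h2 := hasDerivAt_jacobiTheta₂_path hτ (((hξ.div_const (π : ℂ)).add
    (hT.const_mul a)).add_const b) hT
  refine (h1.mul h2).congr_deriv ?_
  simp only [thetaCharDeriv, thetaCharDeriv2, Pi.add_apply]
  field_simp
  ring_nf
  simp only [I_sq]
  ring

lemma hasDerivAt_thetaChar (a b z : ℂ) {τ : ℂ} (hτ : 0 < τ.im) :
    HasDerivAt (fun z => thetaChar a b z τ) (thetaCharDeriv a b z τ) z := by
  simpa using hasDerivAt_thetaChar_path a b (ξ := fun z => z) (T := fun _ => τ) hτ
    (hasDerivAt_id z) (hasDerivAt_const z τ)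

lemma hasDerivAt_thetaCharDeriv (a b z : ℂ) {τ : ℂ} (hτ : 0 < τ.im) :
    HasDerivAt (fun z => thetaCharDeriv a b z τ) (thetaCharDeriv2 a b z τ) z := by
  have hπ := pi_ne_zero'
  have h0 : HasDerivAt (fun z : ℂ => z / π + a * τ + b) (1 / π) z := by
    simpa using (((hasDerivAt_id z).div_const (π : ℂ)).add_const (a * τ)).add_const b
  have h1 : HasDerivAt (fun z : ℂ => cexp (I * π * τ * a ^ 2 + 2 * I * a * z))
      (cexp (I * π * τ * a ^ 2 + 2 * I * a * z) * (2 * I * a)) z := by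
    have := ((hasDerivAt_id z).const_mul (2 * I * a)).const_add (I * π * τ * a ^ 2)
    simpa using this.cexp
  have h2 := (hasDerivAt_jacobiTheta₂_fst (z / π + a * τ + b) hτ).comp z h0
  have h3 := (hasDerivAt_jacobiTheta₂'_fst (z / π + a * τ + b) hτ).comp z h0
  refine (h1.mul ((h2.const_mul (2 * I * a)).add (h3.div_const (π : ℂ)))).congr_deriv ?_
  simp only [thetaCharDeriv2, Function.comp, Pi.add_apply]
  field_simp
  ring_nf
  simp only [I_sq]
  ring

/-! ### Derivatives of the four theta functions -/

/-- The derivative of `theta1` in its first argument. -/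
noncomputable def theta1d (z τ : ℂ) : ℂ := -I * thetaCharDeriv (1 / 2) (1 / 2) z τ
/-- The derivative of `theta2` in its first argument. -/
noncomputable def theta2d (z τ : ℂ) : ℂ := thetaCharDeriv (1 / 2) 0 z τ
/-- The derivative of `theta3` in its first argument. -/
noncomputable def theta3d (z τ : ℂ) : ℂ := thetaCharDeriv 0 0 z τ
/-- The derivative of `theta4` in its first argument. -/
noncomputable def theta4d (z τ : ℂ) : ℂ := thetaCharDeriv 0 (1 / 2) z τ
/-- The second derivative of `theta1` in its first argument. -/
noncomputable def theta1dd (z τ : ℂ) : ℂ := -I * thetaCharDeriv2 (1 / 2) (1 / 2) z τ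
/-- The second derivative of `theta2` in its first argument. -/
noncomputable def theta2dd (z τ : ℂ) : ℂ := thetaCharDeriv2 (1 / 2) 0 z τ
/-- The second derivative of `theta3` in its first argument. -/
noncomputable def theta3dd (z τ : ℂ) : ℂ := thetaCharDeriv2 0 0 z τ
/-- The second derivative of `theta4` in its first argument. -/
noncomputable def theta4dd (z τ : ℂ) : ℂ := thetaCharDeriv2 0 (1 / 2) z τ

section Derivatives

variable (z : ℂ) {τ : ℂ} (hτ : 0 < τ.im)
include hτ

lemma hasDerivAt_theta1 : HasDerivAt (fun z => theta1 z τ) (theta1d z τ) z := by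
  simp_rw [theta1_eq]; exact (hasDerivAt_thetaChar _ _ z hτ).const_mul _

lemma hasDerivAt_theta2 : HasDerivAt (fun z => theta2 z τ) (theta2d z τ) z := by
  simp_rw [theta2_eq]; exact hasDerivAt_thetaChar _ _ z hτ

lemma hasDerivAt_theta3 : HasDerivAt (fun z => theta3 z τ) (theta3d z τ) z := by
  simp_rw [theta3_eq]; exact hasDerivAt_thetaChar _ _ z hτ

lemma hasDerivAt_theta4 : HasDerivAt (fun z => theta4 z τ) (theta4d z τ) z := by
  simp_rw [theta4_eq]; exact hasDerivAt_thetaChar _ _ z hτ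

lemma hasDerivAt_theta1d : HasDerivAt (fun z => theta1d z τ) (theta1dd z τ) z :=
  (hasDerivAt_thetaCharDeriv _ _ z hτ).const_mul _

lemma hasDerivAt_theta2d : HasDerivAt (fun z => theta2d z τ) (theta2dd z τ) z :=
  hasDerivAt_thetaCharDeriv _ _ z hτ

lemma hasDerivAt_theta3d : HasDerivAt (fun z => theta3d z τ) (theta3dd z τ) z :=
  hasDerivAt_thetaCharDeriv _ _ z hτ

lemma hasDerivAt_theta4d : HasDerivAt (fun z => theta4d z τ) (theta4dd z τ) z :=
  hasDerivAt_thetaCharDeriv _ _ z hτ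

end Derivatives

section Path

variable {ξ T : ℂ → ℂ} {ξ' T' s : ℂ} (hτ : 0 < (T s).im)
  (hξ : HasDerivAt ξ ξ' s) (hT : HasDerivAt T T' s)
include hτ hξ hT

lemma hasDerivAt_theta1_path : HasDerivAt (fun s => theta1 (ξ s) (T s))
    (theta1d (ξ s) (T s) * ξ' + -(I * π / 4) * theta1dd (ξ s) (T s) * T') s := by
  simp_rw [theta1_eq]
  refine ((hasDerivAt_thetaChar_path _ _ hτ hξ hT).const_mul (-I)).congr_deriv ?_
  rw [theta1d, theta1dd]; ring

lemma hasDerivAt_theta2_path : HasDerivAt (fun s => theta2 (ξ s) (T s))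
    (theta2d (ξ s) (T s) * ξ' + -(I * π / 4) * theta2dd (ξ s) (T s) * T') s := by
  simp_rw [theta2_eq]; exact hasDerivAt_thetaChar_path _ _ hτ hξ hT

lemma hasDerivAt_theta3_path : HasDerivAt (fun s => theta3 (ξ s) (T s))
    (theta3d (ξ s) (T s) * ξ' + -(I * π / 4) * theta3dd (ξ s) (T s) * T') s := by
  simp_rw [theta3_eq]; exact hasDerivAt_thetaChar_path _ _ hτ hξ hT

lemma hasDerivAt_theta4_path : HasDerivAt (fun s => theta4 (ξ s) (T s))
    (theta4d (ξ s) (T s) * ξ' + -(I * π / 4) * theta4dd (ξ s) (T s) * T') s := by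
  simp_rw [theta4_eq]; exact hasDerivAt_thetaChar_path _ _ hτ hξ hT

end Path

/-! ### Products of two theta functions -/

lemma thetaChar_one_left (b z τ : ℂ) :
    thetaChar 1 b z τ = cexp (-(2 * π * I * b)) * thetaChar 0 b z τ := by
  have := thetaChar_add_one_left 0 b z τ
  rwa [zero_add] at this

lemma thetaChar_one_right (a z τ : ℂ) : thetaChar a 1 z τ = thetaChar a 0 z τ := by
  have := thetaChar_add_one_right a 0 z τ
  rwa [zero_add] at this

lemma exp_neg_pi_half : cexp (-(2 * π * I * (1 / 2))) = -1 := by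
  rw [Complex.exp_neg, exp_pi_half]; norm_num

/-- Negation followed by unit shifts of both characteristics returns `(1/2, 1/2)` with the sign
`-1`, so `θ₁` is odd. -/
lemma theta1_zero (τ : ℂ) : theta1 0 τ = 0 := by
  have h1 := thetaChar_neg (1 / 2) (1 / 2) 0 τ
  have h2 := thetaChar_add_one_left (-(1 / 2)) (-(1 / 2)) 0 τ
  have h3 := thetaChar_add_one_right (1 / 2) (-(1 / 2)) 0 τ
  have h4 : cexp (-(2 * π * I * -(1 / 2))) = -1 := by rw [← exp_pi_half]; congr 1; ring
  rw [show (-(1 / 2) + 1 : ℂ) = 1 / 2 by norm_num] at h2 h3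
  rw [h4] at h2
  rw [neg_zero] at h1
  rw [theta1_eq]
  linear_combination (-I / 2) * (h3 + h2 - h1)

section Products

variable (u v : ℂ) {τ : ℂ} (hτ : 0 < τ.im)
include hτ

lemma theta3_mul_theta3 : theta3 u τ * theta3 v τ =
    theta3 (u + v) (2 * τ) * theta3 (u - v) (2 * τ) +
      theta2 (u + v) (2 * τ) * theta2 (u - v) (2 * τ) := by
  have := thetaChar_mul 0 0 0 0 u v hτ
  simp only [theta3_eq, theta2_eq, this]
  norm_num

lemma theta4_mul_theta4 : theta4 u τ * theta4 v τ =
    theta3 (u + v) (2 * τ) * theta3 (u - v) (2 * τ) -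
      theta2 (u + v) (2 * τ) * theta2 (u - v) (2 * τ) := by
  have := thetaChar_mul 0 (1 / 2) 0 (1 / 2) u v hτ
  simp only [theta4_eq, theta3_eq, theta2_eq, this, exp_pi_half]
  norm_num [thetaChar_one_right]
  ring

lemma theta2_mul_theta2 : theta2 u τ * theta2 v τ =
    theta2 (u + v) (2 * τ) * theta3 (u - v) (2 * τ) +
      theta3 (u + v) (2 * τ) * theta2 (u - v) (2 * τ) := by
  have := thetaChar_mul (1 / 2) 0 (1 / 2) 0 u v hτ
  simp only [theta3_eq, theta2_eq, this]
  norm_num [thetaChar_one_left]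

lemma theta1_mul_theta1 : theta1 u τ * theta1 v τ =
    theta3 (u + v) (2 * τ) * theta2 (u - v) (2 * τ) -
      theta2 (u + v) (2 * τ) * theta3 (u - v) (2 * τ) := by
  have h := thetaChar_mul (1 / 2) (1 / 2) (1 / 2) (1 / 2) u v hτ
  have e : cexp (-(2 * π * I)) = 1 := by rw [Complex.exp_neg, exp_two_pi_mul_I, inv_one]
  rw [exp_pi_half] at h
  norm_num [thetaChar_one_left, thetaChar_one_right, e] at h
  simp only [theta1_eq, theta3_eq, theta2_eq]
  norm_num
  linear_combination -h + (thetaChar (1 / 2) (1 / 2) u τ * thetaChar (1 / 2) (1 / 2) v τ) * I_sq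

lemma theta1_mul_theta2 : theta1 u τ * theta2 v τ =
    theta1 (u + v) (2 * τ) * theta4 (u - v) (2 * τ) +
      theta4 (u + v) (2 * τ) * theta1 (u - v) (2 * τ) := by
  have h := thetaChar_mul (1 / 2) (1 / 2) (1 / 2) 0 u v hτ
  rw [exp_pi_half] at h
  have e := exp_neg_pi_half
  norm_num [thetaChar_one_left] at h e
  simp only [theta1_eq, theta4_eq, theta2_eq]
  norm_num
  simp only [e] at h
  linear_combination -I * h

/-- The odd part of the product formula carries the factor `θ₁(0|2τ) = 0`. This is the
geometric-mean half of the AGM step, and it propagates zeros of `θ₄` along `τ ↦ 2τ`. -/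
lemma theta3_mul_theta4_zero : theta3 0 τ * theta4 0 τ = theta4 0 (2 * τ) ^ 2 := by
  have h := thetaChar_mul 0 0 0 (1 / 2) 0 0 hτ
  have h1 := thetaChar_add_one_right 0 (-(1 / 2)) 0 (2 * τ)
  have h2 : thetaChar (1 / 2) (1 / 2) 0 (2 * τ) = 0 := by
    simpa [theta1_eq] using theta1_zero (2 * τ)
  rw [show (-(1 / 2) + 1 : ℂ) = 1 / 2 by norm_num] at h1
  norm_num at h h1 h2
  simp only [theta3_eq, theta4_eq]
  norm_num
  rw [h, h2, ← h1]
  ring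

/-- The quarter characteristics are half-sums of `1/2` and `0`. This product and that of `θ₁, θ₄`
involve the same functions at `2τ`, which is what ties the two Wronskians to the two products. -/
lemma theta2_mul_theta3 : theta2 u τ * theta3 v τ =
    thetaChar (1 / 4) 0 (u + v) (2 * τ) * thetaChar (1 / 4) 0 (u - v) (2 * τ) +
      thetaChar (3 / 4) 0 (u + v) (2 * τ) * thetaChar (3 / 4) 0 (u - v) (2 * τ) := by
  have := thetaChar_mul (1 / 2) 0 0 0 u v hτ
  simp only [theta3_eq, theta2_eq, this]
  norm_num

lemma theta1_mul_theta4 : theta1 u τ * theta4 v τ =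
    -I * (thetaChar (1 / 4) 0 (u + v) (2 * τ) * thetaChar (1 / 4) 0 (u - v) (2 * τ) -
      thetaChar (3 / 4) 0 (u + v) (2 * τ) * thetaChar (3 / 4) 0 (u - v) (2 * τ)) := by
  have h := thetaChar_mul (1 / 2) (1 / 2) 0 (1 / 2) u v hτ
  rw [exp_pi_half] at h
  norm_num [thetaChar_one_right] at h
  simp only [theta1_eq, theta4_eq]
  norm_num
  linear_combination I * h

lemma theta3_sq_add_theta4_sq : theta3 0 τ ^ 2 + theta4 0 τ ^ 2 = 2 * theta3 0 (2 * τ) ^ 2 := by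
  have h3 := theta3_mul_theta3 0 0 hτ
  have h4 := theta4_mul_theta4 0 0 hτ
  simp only [add_zero, sub_zero] at h3 h4
  linear_combination h3 + h4

lemma theta2_sq : theta2 0 τ ^ 2 = 2 * theta2 0 (2 * τ) * theta3 0 (2 * τ) := by
  have h := theta2_mul_theta2 0 0 hτ
  simp only [add_zero, sub_zero] at h
  linear_combination h

/-! ### Quadratic relations and the addition formula -/

variable (z : ℂ)

/-- At equal arguments each square is a form in `θ₂` and `θ₃` at `2τ`, taken at `2z` and at `0`, so
the relation becomes a polynomial identity. -/
lemma theta_quadratic_cn : theta3 0 τ ^ 2 * theta1 z τ ^ 2 + theta4 0 τ ^ 2 * theta2 z τ ^ 2 =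
    theta2 0 τ ^ 2 * theta4 z τ ^ 2 := by
  have h3 := theta3_mul_theta3 0 0 hτ
  have h4 := theta4_mul_theta4 0 0 hτ
  have h2 := theta2_mul_theta2 0 0 hτ
  have h1z := theta1_mul_theta1 z z hτ
  have h2z := theta2_mul_theta2 z z hτ
  have h4z := theta4_mul_theta4 z z hτ
  simp only [pow_two, h3, h4, h2, h1z, h2z, h4z, add_zero, sub_self]
  ring

lemma theta_quadratic_dn : theta2 0 τ ^ 2 * theta1 z τ ^ 2 + theta4 0 τ ^ 2 * theta3 z τ ^ 2 =
    theta3 0 τ ^ 2 * theta4 z τ ^ 2 := by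
  have h3 := theta3_mul_theta3 0 0 hτ
  have h4 := theta4_mul_theta4 0 0 hτ
  have h2 := theta2_mul_theta2 0 0 hτ
  have h1z := theta1_mul_theta1 z z hτ
  have h3z := theta3_mul_theta3 z z hτ
  have h4z := theta4_mul_theta4 z z hτ
  simp only [pow_two, h3, h4, h2, h1z, h3z, h4z, add_zero, sub_self]
  ring

/-- Jacobi's identity `θ₂⁴ + θ₄⁴ = θ₃⁴`. -/
lemma theta_quartic : theta2 0 τ ^ 4 + theta4 0 τ ^ 4 = theta3 0 τ ^ 4 := by
  have h3 := theta3_mul_theta3 0 0 hτ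
  have h4 := theta4_mul_theta4 0 0 hτ
  have h2 := theta2_mul_theta2 0 0 hτ
  simp only [show ∀ x : ℂ, x ^ 4 = (x * x) * (x * x) by intro x; ring, h3, h4, h2, add_zero,
    sub_zero]
  ring

lemma theta1_addition (w : ℂ) : theta1 (z + w) τ * theta1 (z - w) τ * theta4 0 τ ^ 2 =
    theta1 z τ ^ 2 * theta4 w τ ^ 2 - theta4 z τ ^ 2 * theta1 w τ ^ 2 := by
  have h := theta1_mul_theta1 (z + w) (z - w) hτ
  have h4 := theta4_mul_theta4 0 0 hτ
  have h1z := theta1_mul_theta1 z z hτ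
  have h4z := theta4_mul_theta4 z z hτ
  have h1w := theta1_mul_theta1 w w hτ
  have h4w := theta4_mul_theta4 w w hτ
  rw [show z + w + (z - w) = z + z by ring, show z + w - (z - w) = w + w by ring] at h
  simp only [pow_two, h, h4, h1z, h4z, h1w, h4w, add_zero, sub_self]
  ring

lemma theta4d_zero : theta4d 0 τ = 0 := by
  have h : ∀ z, theta4 (-z) τ = theta4 z τ := by
    intro z
    rw [theta4_eq, theta4_eq, ← thetaChar_neg 0 (1 / 2) z, neg_zero,
      ← thetaChar_add_one_right 0 (-(1 / 2))]
    norm_num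
  have h0 := hasDerivAt_theta4 0 hτ
  have h0' : HasDerivAt (fun z => theta4 z τ) (theta4d 0 τ) (-0) := by simpa using h0
  have h1 := h0'.comp 0 (hasDerivAt_neg (0 : ℂ))
  have h2 : HasDerivAt (fun z => theta4 z τ) (theta4d 0 τ * -1) 0 :=
    h1.congr_of_eventuallyEq (Eventually.of_forall fun z => (h z).symm)
  have := h0.unique h2
  linear_combination this / 2

/-- The second logarithmic derivative of `theta1`. -/
lemma theta1_log_deriv2 : theta4 0 τ ^ 2 * (theta1dd z τ * theta1 z τ - theta1d z τ ^ 2) =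
    theta1 z τ ^ 2 * (theta4 0 τ * theta4dd 0 τ) - theta4 z τ ^ 2 * theta1d 0 τ ^ 2 := by
  have hp : ∀ w, HasDerivAt (fun w => z + w) 1 w := fun w => (hasDerivAt_id w).const_add z
  have hm : ∀ w, HasDerivAt (fun w => z - w) (-1) w := fun w => (hasDerivAt_id w).const_sub z
  have p1 : ∀ w, HasDerivAt (fun w => theta1 (z + w) τ) (theta1d (z + w) τ) w := fun w =>
    ((hasDerivAt_theta1 (z + w) hτ).comp w (hp w)).congr_deriv (mul_one _)
  have p1' : ∀ w, HasDerivAt (fun w => theta1d (z + w) τ) (theta1dd (z + w) τ) w := fun w =>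
    ((hasDerivAt_theta1d (z + w) hτ).comp w (hp w)).congr_deriv (mul_one _)
  have m1 : ∀ w, HasDerivAt (fun w => theta1 (z - w) τ) (-theta1d (z - w) τ) w := fun w =>
    ((hasDerivAt_theta1 (z - w) hτ).comp w (hm w)).congr_deriv (mul_neg_one _)
  have m1' : ∀ w, HasDerivAt (fun w => theta1d (z - w) τ) (-theta1dd (z - w) τ) w := fun w =>
    ((hasDerivAt_theta1d (z - w) hτ).comp w (hm w)).congr_deriv (mul_neg_one _)
  have q1 := fun w => hasDerivAt_theta1 w hτ
  have q4 := fun w => hasDerivAt_theta4 w hτ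
  -- The addition formula is differentiated in `w` with `z` fixed. The first derivative is needed
  -- for all `w`; the second is taken only at `w = 0`, where `θ₁(0) = 0` and `θ₄'(0) = 0` remove the
  -- unwanted terms.
  have h1 : ∀ w, (theta1d (z + w) τ * theta1 (z - w) τ +
      theta1 (z + w) τ * -theta1d (z - w) τ) * theta4 0 τ ^ 2 =
      theta1 z τ ^ 2 * (2 * theta4 w τ * theta4d w τ) -
        theta4 z τ ^ 2 * (2 * theta1 w τ * theta1d w τ) := by
    intro w
    have hl := ((p1 w).mul (m1 w)).mul_const (theta4 0 τ ^ 2)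
    have hr := (((q4 w).pow 2).const_mul (theta1 z τ ^ 2)).sub
      (((q1 w).pow 2).const_mul (theta4 z τ ^ 2))
    have hr' := hr.congr_of_eventuallyEq (f₁ := fun w => theta1 (z + w) τ * theta1 (z - w) τ *
      theta4 0 τ ^ 2) (Eventually.of_forall fun w => by
        simpa using theta1_addition hτ z w)
    have := hl.unique hr'
    simpa using this
  have hl := (((p1' 0).mul (m1 0)).add ((p1 0).mul (m1' 0).neg)).mul_const (theta4 0 τ ^ 2)
  have hr := ((((q4 0).const_mul 2).mul (hasDerivAt_theta4d 0 hτ)).const_mul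
    (theta1 z τ ^ 2)).sub ((((q1 0).const_mul 2).mul (hasDerivAt_theta1d 0 hτ)).const_mul
    (theta4 z τ ^ 2))
  have := hl.unique (hr.congr_of_eventuallyEq (Eventually.of_forall fun w => by
    simpa using h1 w))
  simp only [add_zero, sub_zero, Pi.neg_apply, theta1_zero, theta4d_zero hτ] at this
  linear_combination this / 2

/-! ### Wronskians -/

omit hτ in
lemma thetaChar_three_quarters (z τ : ℂ) :
    thetaChar (3 / 4) 0 z τ = thetaChar (1 / 4) 0 (-z) τ := by
  have h1 := thetaChar_add_one_left (-(1 / 4)) 0 z τ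
  have h2 := thetaChar_neg (1 / 4) 0 (-z) τ
  rw [neg_neg, neg_zero] at h2
  rw [h2, show (-(1 / 4) + 1 : ℂ) = 3 / 4 by norm_num] at h1
  simpa using h1

/-- The Wronskians of `θ₁, θ₄` and of `θ₂, θ₃` up to a common factor. -/
lemma theta_wronskians : ∃ c s : ℂ, theta2 0 τ * theta3 0 τ = 2 * s ^ 2 ∧ ∀ z,
    s * (theta1d z τ * theta4 z τ - theta1 z τ * theta4d z τ) = c * (theta2 z τ * theta3 z τ) ∧
    s * (theta2d z τ * theta3 z τ - theta2 z τ * theta3d z τ) =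
      -c * (theta1 z τ * theta4 z τ) := by
  have h2 : 0 < (2 * τ).im := by simpa using hτ
  set S : ℂ → ℂ := fun z => thetaChar (1 / 4) 0 z (2 * τ) with hS
  set S' : ℂ := thetaCharDeriv (1 / 4) 0 0 (2 * τ)
  have h23 : ∀ u v, theta2 u τ * theta3 v τ =
      S (u + v) * S (u - v) + S (-(u + v)) * S (-(u - v)) := fun u v => by
    rw [theta2_mul_theta3 u v hτ,
      thetaChar_three_quarters, thetaChar_three_quarters]
  have h14 : ∀ u v, theta1 u τ * theta4 v τ =
      -I * (S (u + v) * S (u - v) - S (-(u + v)) * S (-(u - v))) := fun u v => by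
    rw [theta1_mul_theta4 u v hτ,
      thetaChar_three_quarters, thetaChar_three_quarters]
  -- With arguments `z + w` and `z - w` the sum `2z` is fixed, so only `S(±2w)` varies, with
  -- derivative `±2S'` at `w = 0`. The derivative of the product at `w = 0` is the Wronskian, while
  -- at `w = 0` the products themselves carry the factor `S 0`.
  refine ⟨-2 * I * S', S 0, ?_, fun z => ?_⟩
  · rw [h23]; simp; ring
  have hp : HasDerivAt (fun w => z + w) 1 0 := (hasDerivAt_id (0 : ℂ)).const_add z
  have hm : HasDerivAt (fun w => z - w) (-1) 0 := (hasDerivAt_id (0 : ℂ)).const_sub z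
  have S1 : HasDerivAt (fun w => S (2 * w)) (S' * 2) 0 := by
    have : HasDerivAt S S' (2 * 0) := by
      simpa only [mul_zero, neg_zero] using hasDerivAt_thetaChar (1 / 4) 0 0 h2
    exact this.comp 0 (((hasDerivAt_id (0 : ℂ)).const_mul 2).congr_deriv (mul_one _))
  have S2 : HasDerivAt (fun w => S (-(2 * w))) (S' * -2) 0 := by
    have : HasDerivAt S S' (-(2 * 0)) := by
      simpa only [mul_zero, neg_zero] using hasDerivAt_thetaChar (1 / 4) 0 0 h2
    exact this.comp 0 (((hasDerivAt_id (0 : ℂ)).const_mul 2).neg.congr_deriv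
      (by norm_num : _ = (-2 : ℂ)))
  have a1 : HasDerivAt (fun w => theta1 (z + w) τ) (theta1d (z + 0) τ * 1) 0 :=
    (hasDerivAt_theta1 (z + 0) hτ).comp 0 hp
  have a2 : HasDerivAt (fun w => theta2 (z + w) τ) (theta2d (z + 0) τ * 1) 0 :=
    (hasDerivAt_theta2 (z + 0) hτ).comp 0 hp
  have a3 : HasDerivAt (fun w => theta3 (z - w) τ) (theta3d (z - 0) τ * -1) 0 :=
    (hasDerivAt_theta3 (z - 0) hτ).comp 0 hm
  have a4 : HasDerivAt (fun w => theta4 (z - w) τ) (theta4d (z - 0) τ * -1) 0 :=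
    (hasDerivAt_theta4 (z - 0) hτ).comp 0 hm
  have e1 := (a1.mul a4).unique ((((S1.const_mul (S (2 * z))).sub
    (S2.const_mul (S (-(2 * z))))).const_mul (-I)).congr_of_eventuallyEq
      (Eventually.of_forall fun w => by
        simp only [Pi.mul_apply, Pi.sub_apply, h14]
        rw [show z + w + (z - w) = 2 * z by ring, show z + w - (z - w) = 2 * w by ring]))
  have e2 := (a2.mul a3).unique (((S1.const_mul (S (2 * z))).add
    (S2.const_mul (S (-(2 * z))))).congr_of_eventuallyEq
      (Eventually.of_forall fun w => by
        simp only [Pi.mul_apply, Pi.add_apply, h23]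
        rw [show z + w + (z - w) = 2 * z by ring, show z + w - (z - w) = 2 * w by ring]))
  have f1 := h23 z z
  have f2 := h14 z z
  simp only [← two_mul, sub_self, neg_zero, add_zero, sub_zero, mul_one] at e1 e2 f1 f2
  rw [f1, f2]
  constructor
  · linear_combination S 0 * e1
  · linear_combination S 0 * e2 + 2 * S' * S 0 * (S (2 * z) - S (-(2 * z))) * I_sq

end Products

/-! ### Behaviour at the cusp -/

/-- Dominated convergence: the exponents are nonnegative, so only the terms with `e n = 0` survive
as `Im τ → ∞`. For `Im τ ≥ 1` the bound `n² - |n| ≤ e n` gives a majorant independent of `τ`. -/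
lemma tendsto_tsum_exp_im_atTop {c : ℤ → ℂ} {e : ℤ → ℤ} {C : ℝ}
    (hc : ∀ n, ‖c n‖ ≤ C * (|n| + 1)) (he : ∀ n, n ^ 2 - |n| ≤ e n) :
    Tendsto (fun τ => ∑' n, c n * cexp (I * π * τ * e n)) (comap im atTop)
      (𝓝 (∑' n, if e n = 0 then c n else 0)) := by
  have he0 : ∀ n, 0 ≤ e n := fun n => by
    refine le_trans ?_ (he n)
    rcases eq_or_ne n 0 with rfl | hn
    · simp
    · have := Int.one_le_abs hn
      nlinarith [sq_abs n]
  have hnorm : ∀ (τ : ℂ) (n : ℤ), ‖cexp (I * π * τ * e n)‖ = rexp (-(π * τ.im * e n)) := by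
    intro τ n
    rw [Complex.norm_exp]
    congr 1
    simp [mul_re]
  refine tendsto_tsum_of_dominated_convergence
    (bound := fun n : ℤ => C * (|n| + 1) * rexp (-π * (1 * n ^ 2 - 2 * (1 / 2) * |n|))) ?_ ?_ ?_
  · have h1 := summable_pow_mul_jacobiTheta₂_term_bound (1 / 2) one_pos 1
    have h0 := summable_pow_mul_jacobiTheta₂_term_bound (1 / 2) one_pos 0
    refine ((h1.add h0).mul_left C).congr fun n => ?_
    push_cast
    ring
  · intro n
    split_ifs with h
    · simpa [h] using tendsto_const_nhds
    · have hpos : (0 : ℝ) < e n := by exact_mod_cast lt_of_le_of_ne (he0 n) (Ne.symm h)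
      rw [tendsto_zero_iff_norm_tendsto_zero]
      simp_rw [norm_mul, hnorm]
      rw [← mul_zero ‖c n‖]
      refine Tendsto.const_mul _ (Real.tendsto_exp_neg_atTop_nhds_zero.comp ?_)
      exact (tendsto_comap.const_mul_atTop Real.pi_pos).atTop_mul_const hpos
  · have : ∀ᶠ τ : ℂ in comap im atTop, 1 ≤ τ.im := tendsto_comap.eventually (eventually_ge_atTop 1)
    filter_upwards [this] with τ hτ n
    rw [norm_mul, hnorm]
    have h1 : ((n ^ 2 - |n| : ℤ) : ℝ) ≤ e n := by exact_mod_cast he n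
    have h2 : (0 : ℝ) ≤ e n := by exact_mod_cast he0 n
    have h3 : rexp (-(π * τ.im * e n)) ≤ rexp (-π * (1 * n ^ 2 - 2 * (1 / 2) * |n|)) := by
      apply Real.exp_le_exp.mpr
      push_cast at h1
      have : (e n : ℝ) ≤ τ.im * e n := le_mul_of_one_le_left h2 hτ
      rw [neg_mul, neg_le_neg_iff, mul_assoc π]
      push_cast
      refine mul_le_mul_of_nonneg_left ?_ Real.pi_pos.le
      linarith
    exact mul_le_mul (by exact_mod_cast hc n) h3 (Real.exp_pos _).le
      ((norm_nonneg _).trans (by exact_mod_cast hc n))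

lemma eventually_im_pos : ∀ᶠ τ : ℂ in comap im atTop, 0 < τ.im :=
  tendsto_comap.eventually (eventually_gt_atTop 0)

lemma norm_exp_two_pi_int (b : ℝ) (n : ℤ) : ‖cexp (2 * π * I * n * b)‖ = 1 := by
  rw [show (2 * π * I * n * b : ℂ) = ((2 * π * n * b : ℝ) : ℂ) * I by push_cast; ring]
  exact norm_exp_ofReal_mul_I _

lemma tsum_ite_sq (c : ℤ → ℂ) : ∑' n : ℤ, (if n ^ 2 = 0 then c n else 0) = c 0 := by
  rw [tsum_eq_single 0]
  · simp
  · intro n hn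
    simp [hn]

lemma tsum_ite_sq_add (c : ℤ → ℂ) :
    ∑' n : ℤ, (if n ^ 2 + n = 0 then c n else 0) = c 0 + c (-1) := by
  rw [tsum_eq_sum (s := {0, -1})]
  · simp
  · intro n hn
    simp only [Finset.mem_insert, Finset.mem_singleton, not_or] at hn
    have : n ^ 2 + n ≠ 0 := by
      intro h
      have : n * (n + 1) = 0 := by linarith
      rcases mul_eq_zero.mp this with h | h
      · exact hn.1 h
      · exact hn.2 (by linarith)
    simp [this]

lemma tendsto_thetaChar_zero (b : ℝ) :
    Tendsto (fun τ => thetaChar 0 b 0 τ) (comap im atTop) (𝓝 1) := by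
  have h := tendsto_tsum_exp_im_atTop (c := fun n => cexp (2 * π * I * n * b))
    (e := fun n => n ^ 2) (C := 1) (fun n => by
      rw [norm_exp_two_pi_int]; have : (0 : ℝ) ≤ |n| := by positivity
      linarith) (fun n => by have := abs_nonneg n; linarith)
  rw [tsum_ite_sq] at h
  simp only [Int.cast_zero, mul_zero, zero_mul, Complex.exp_zero] at h
  refine h.congr' ?_
  filter_upwards [eventually_im_pos] with τ hτ
  rw [← (hasSum_thetaChar 0 b 0 hτ).tsum_eq]
  refine tsum_congr fun n => ?_
  rw [thetaCharTerm, ← Complex.exp_add]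
  congr 1
  push_cast
  ring

lemma tendsto_theta3 : Tendsto (theta3 0) (comap im atTop) (𝓝 1) := by
  simpa [funext (theta3_eq 0)] using tendsto_thetaChar_zero 0

lemma tendsto_theta4 : Tendsto (theta4 0) (comap im atTop) (𝓝 1) := by
  simpa [funext (theta4_eq 0)] using tendsto_thetaChar_zero (1 / 2)

lemma sq_sub_abs_le (n : ℤ) : n ^ 2 - |n| ≤ n ^ 2 + n := by
  have := neg_abs_le n; linarith

lemma tendsto_theta2 :
    Tendsto (fun τ => cexp (-(I * π * τ / 4)) * theta2 0 τ) (comap im atTop) (𝓝 2) := by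
  have h := tendsto_tsum_exp_im_atTop (c := fun _ => 1)
    (e := fun n => n ^ 2 + n) (C := 1) (fun n => by simp) sq_sub_abs_le
  rw [tsum_ite_sq_add, one_add_one_eq_two] at h
  refine h.congr' ?_
  filter_upwards [eventually_im_pos] with τ hτ
  rw [theta2_eq, ← (hasSum_thetaChar (1 / 2) 0 0 hτ).tsum_eq, ← tsum_mul_left]
  refine tsum_congr fun n => ?_
  rw [thetaCharTerm, ← Complex.exp_add, one_mul]
  congr 1
  push_cast
  ring

lemma hasSum_thetaCharDeriv (a b z : ℂ) {τ : ℂ} (hτ : 0 < τ.im) :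
    HasSum (fun n => 2 * I * (n + a) * thetaCharTerm a b z τ n) (thetaCharDeriv a b z τ) := by
  have hπ := pi_ne_zero'
  refine ((((hasSum_jacobiTheta₂_term (z / π + a * τ + b) hτ).mul_left (2 * I * a)).add
    ((hasSum_jacobiTheta₂'_term (z / π + a * τ + b) hτ).div_const (π : ℂ))).mul_left
    (cexp (I * π * τ * a ^ 2 + 2 * I * a * z))).congr_fun fun n => ?_
  rw [thetaCharTerm_eq, jacobiTheta₂'_term]
  field_simp
  ring

lemma tendsto_theta1d :
    Tendsto (fun τ => cexp (-(I * π * τ / 4)) * theta1d 0 τ) (comap im atTop) (𝓝 2) := by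
  have h := tendsto_tsum_exp_im_atTop
    (c := fun n => (2 * n + 1) * cexp (2 * π * I * n * (1 / 2 : ℝ)))
    (e := fun n => n ^ 2 + n) (C := 2) (fun n => by
      rw [norm_mul, norm_exp_two_pi_int, mul_one]
      refine (norm_add_le _ _).trans ?_
      rw [norm_mul, norm_intCast, norm_one, Int.cast_abs]
      norm_num
      linarith) sq_sub_abs_le
  have e1 : cexp (2 * π * I * (-1 : ℤ) * (1 / 2 : ℝ)) = -1 := by
    rw [← exp_neg_pi_half]; congr 1; push_cast; ring
  rw [tsum_ite_sq_add, e1] at h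
  norm_num at h
  refine h.congr' ?_
  filter_upwards [eventually_im_pos] with τ hτ
  rw [theta1d, ← (hasSum_thetaCharDeriv (1 / 2) (1 / 2) 0 hτ).tsum_eq, ← tsum_mul_left,
    ← tsum_mul_left]
  refine tsum_congr fun n => ?_
  have : cexp (-(I * π * τ / 4)) * thetaCharTerm (1 / 2) (1 / 2) 0 τ n =
      cexp (2 * π * I * n * (1 / 2)) * cexp (I * π * τ * (n ^ 2 + n)) := by
    rw [thetaCharTerm, ← Complex.exp_add, ← Complex.exp_add]
    congr 1
    ring
  norm_num at this ⊢
  rw [mul_assoc, ← this]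
  linear_combination
    ((2 * n + 1) * (cexp (-(I * π * τ / 4)) * thetaCharTerm (1 / 2) (1 / 2) 0 τ n)) * I_sq

/-! ### Nonvanishing of the theta constants and Jacobi's derivative formula -/

lemma tendsto_two_pow_mul {τ : ℂ} (hτ : 0 < τ.im) :
    Tendsto (fun k : ℕ => 2 ^ k * τ) atTop (comap im atTop) := by
  rw [tendsto_comap_iff]
  have : (im ∘ fun k : ℕ => 2 ^ k * τ) = fun k : ℕ => (2 : ℝ) ^ k * τ.im := by
    ext k
    have : ((2 : ℂ) ^ k) = ((2 ^ k : ℝ) : ℂ) := by push_cast; rfl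
    simp only [Function.comp, this, im_ofReal_mul]
  rw [this]
  exact (tendsto_pow_atTop_atTop_of_one_lt one_lt_two).atTop_mul_const hτ

lemma two_pow_mul_im_pos {τ : ℂ} (hτ : 0 < τ.im) (k : ℕ) : 0 < (2 ^ k * τ).im := by
  have : ((2 : ℂ) ^ k) = ((2 ^ k : ℝ) : ℂ) := by push_cast; rfl
  rw [this, im_ofReal_mul]
  positivity

/-- A property preserved by `τ ↦ 2τ` that fails near the cusp never holds. -/
lemma not_of_doubling {P : ℂ → Prop} (hP : ∀ τ, 0 < τ.im → P τ → P (2 * τ))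
    (h : ∀ᶠ τ in comap im atTop, ¬ P τ) {τ : ℂ} (hτ : 0 < τ.im) : ¬ P τ := by
  intro h0
  have : ∀ k : ℕ, P (2 ^ k * τ) := by
    intro k
    induction k with
    | zero => simpa using h0
    | succ k ih =>
      rw [pow_succ', mul_assoc]
      exact hP _ (two_pow_mul_im_pos hτ k) ih
  obtain ⟨k, hk⟩ := ((tendsto_two_pow_mul hτ).eventually h).exists
  exact hk (this k)

/-- A function invariant under `τ ↦ 2τ` equals its limit at the cusp. -/
lemma eq_of_doubling {f : ℂ → ℂ} {l : ℂ} (hf : ∀ τ, 0 < τ.im → f (2 * τ) = f τ)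
    (h : Tendsto f (comap im atTop) (𝓝 l)) {τ : ℂ} (hτ : 0 < τ.im) : f τ = l := by
  have : ∀ k : ℕ, f (2 ^ k * τ) = f τ := by
    intro k
    induction k with
    | zero => simp
    | succ k ih => rw [pow_succ', mul_assoc, hf _ (two_pow_mul_im_pos hτ k), ih]
  have h1 := h.comp (tendsto_two_pow_mul hτ)
  exact tendsto_nhds_unique (tendsto_const_nhds.congr fun k => (this k).symm) h1

section Nonvanishing

variable {τ : ℂ} (hτ : 0 < τ.im)
include hτ

lemma theta4_zero_ne : theta4 0 τ ≠ 0 := by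
  refine not_of_doubling (P := fun τ => theta4 0 τ = 0) (fun τ hτ h => ?_) ?_ hτ
  · have := theta3_mul_theta4_zero hτ
    rw [h, mul_zero] at this
    exact pow_eq_zero_iff two_ne_zero |>.mp this.symm
  · exact tendsto_theta4.eventually_ne one_ne_zero

lemma theta3_zero_ne : theta3 0 τ ≠ 0 := by
  intro h
  have h1 := theta3_mul_theta4_zero hτ
  rw [h, zero_mul] at h1
  exact theta4_zero_ne (τ := 2 * τ) (by simpa using hτ) (pow_eq_zero_iff two_ne_zero |>.mp h1.symm)

lemma theta2_zero_ne : theta2 0 τ ≠ 0 := by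
  refine not_of_doubling (P := fun τ => theta2 0 τ = 0) (fun τ hτ h => ?_) ?_ hτ
  · have h2 := theta2_sq hτ
    have h3 := theta3_zero_ne (τ := 2 * τ) (by simpa using hτ)
    rw [h] at h2
    simpa [h3] using h2.symm
  · filter_upwards [tendsto_theta2.eventually_ne two_ne_zero] with τ h h0
    simp [h0] at h

/-- Derivative at `z = 0` of `θ₁(z|τ) θ₂(z|τ) = θ₁(2z|2τ) θ₄(0|2τ)`. -/
lemma theta1d_doubling : 2 * theta1d 0 (2 * τ) * theta4 0 (2 * τ) = theta1d 0 τ * theta2 0 τ := by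
  have h2 : 0 < (2 * τ).im := by simpa using hτ
  have hd : HasDerivAt (fun z : ℂ => z + z) 2 0 :=
    ((hasDerivAt_id (0 : ℂ)).add (hasDerivAt_id 0)).congr_deriv (by norm_num)
  have h1 : HasDerivAt (fun z => theta1 (z + z) (2 * τ)) (theta1d (0 + 0) (2 * τ) * 2) 0 :=
    (hasDerivAt_theta1 (0 + 0) h2).comp (h := fun z => z + z) 0 hd
  have hl := (hasDerivAt_theta1 0 hτ).mul (hasDerivAt_theta2 0 hτ)
  have hr := h1.mul_const (theta4 0 (2 * τ))
  have := hl.unique (hr.congr_of_eventuallyEq (Eventually.of_forall fun z => by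
    simp [theta1_mul_theta2 z z hτ, theta1_zero]))
  simp only [theta1_zero, zero_mul, add_zero] at this
  linear_combination -this

/-- Jacobi's derivative formula. -/
theorem theta1d_zero : theta1d 0 τ = theta2 0 τ * theta3 0 τ * theta4 0 τ := by
  -- Numerator and denominator both behave like `2 q^{1/4}` at the cusp, whence the limit `2 / (2 *
  -- 1 * 1)`.
  have key := eq_of_doubling (f := fun τ => theta1d 0 τ / (theta2 0 τ * theta3 0 τ * theta4 0 τ))
    (l := 2 / (2 * 1 * 1)) (fun τ hτ => ?_) ?_ hτ
  · have h2 := theta2_zero_ne hτ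
    have h3 := theta3_zero_ne hτ
    have h4 := theta4_zero_ne hτ
    norm_num at key
    rw [div_eq_one_iff_eq (by simp [h2, h3, h4])] at key
    exact key
  · have h2' : 0 < (2 * τ).im := by simpa using hτ
    have h2 := theta2_zero_ne hτ
    have h3 := theta3_zero_ne hτ
    have h4 := theta4_zero_ne hτ
    have g2 := theta2_zero_ne h2'
    have g3 := theta3_zero_ne h2'
    have g4 := theta4_zero_ne h2'
    have e1 := theta1d_doubling hτ
    have e2 := theta2_sq hτ
    have e3 := theta3_mul_theta4_zero hτ
    rw [div_eq_div_iff (by simp [g2, g3, g4]) (by simp [h2, h3, h4])]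
    refine mul_left_cancel₀ (mul_ne_zero two_ne_zero g4) ?_
    linear_combination (theta2 0 τ * theta3 0 τ * theta4 0 τ) * e1 +
      theta1d 0 τ * theta3 0 τ * theta4 0 τ * e2 +
      2 * theta1d 0 τ * theta2 0 (2 * τ) * theta3 0 (2 * τ) * e3
  · refine (tendsto_theta1d.div ((tendsto_theta2.mul tendsto_theta3).mul tendsto_theta4)
      (by norm_num)).congr fun τ => ?_
    have := Complex.exp_ne_zero (-(I * π * τ / 4))
    simp only [Pi.div_apply]
    rw [mul_assoc (cexp _ * _), mul_assoc (cexp _), mul_div_mul_left _ _ this, ← mul_assoc]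

variable (z : ℂ)

theorem theta1_theta4_wronskian : theta1d z τ * theta4 z τ - theta1 z τ * theta4d z τ =
    theta4 0 τ ^ 2 * (theta2 z τ * theta3 z τ) ∧
    theta2d z τ * theta3 z τ - theta2 z τ * theta3d z τ =
      -theta4 0 τ ^ 2 * (theta1 z τ * theta4 z τ) := by
  obtain ⟨c, s, hs, h⟩ := theta_wronskians hτ
  have h2 := theta2_zero_ne hτ
  have h3 := theta3_zero_ne hτ
  have hs0 : s ≠ 0 := by
    rintro rfl
    simp [h2, h3] at hs
  -- At `z = 0` the Wronskian is `θ₁'(0) θ₄(0)`, and Jacobi's derivative formula determines the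
  -- ratio of `c` to `s`.
  have h0 := (h 0).1
  rw [theta1_zero, zero_mul, sub_zero, theta1d_zero hτ] at h0
  have hc : c = s * theta4 0 τ ^ 2 := by
    apply mul_right_cancel₀ (mul_ne_zero h2 h3)
    linear_combination -h0
  constructor
  · apply mul_left_cancel₀ hs0
    rw [(h z).1, hc]; ring
  · apply mul_left_cancel₀ hs0
    rw [(h z).2, hc]; ring

theorem theta2dd_zero_wronskian : theta2dd 0 τ * theta3 0 τ - theta2 0 τ * theta3dd 0 τ =
    -theta4 0 τ ^ 4 * (theta2 0 τ * theta3 0 τ) := by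
  have hl := ((hasDerivAt_theta2d 0 hτ).mul (hasDerivAt_theta3 0 hτ)).sub
    ((hasDerivAt_theta2 0 hτ).mul (hasDerivAt_theta3d 0 hτ))
  have hr := ((hasDerivAt_theta1 0 hτ).mul (hasDerivAt_theta4 0 hτ)).const_mul
    (-theta4 0 τ ^ 2)
  have := hl.unique (hr.congr_of_eventuallyEq (Eventually.of_forall fun z => by
    simpa using (theta1_theta4_wronskian hτ z).2))
  rw [theta1_zero, theta1d_zero hτ] at this
  linear_combination this

end Nonvanishing

/-! ### Landen's transformation of the complete elliptic integral -/

/-- Gauss' form `∫₀^{π/2} dφ / √(a² cos² φ + b² sin² φ)` of the complete elliptic integral. -/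
noncomputable def gaussIntegral (a b : ℝ) : ℝ :=
  ∫ φ in (0 : ℝ)..(π / 2), 1 / √(a ^ 2 * Real.cos φ ^ 2 + b ^ 2 * Real.sin φ ^ 2)

/-- Substitution `u = b tan φ`. -/
lemma gaussIntegral_eq_integral_Ioi {a b : ℝ} (hb : 0 < b) :
    gaussIntegral a b = ∫ x in Ioi (0 : ℝ), 1 / √((x ^ 2 + a ^ 2) * (x ^ 2 + b ^ 2)) := by
  have hcos : ∀ x ∈ Ioo 0 (π / 2), 0 < Real.cos x := fun x hx =>
    Real.cos_pos_of_mem_Ioo ⟨by linarith [hx.1, Real.pi_pos], hx.2⟩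
  have himage : (fun x => b * Real.tan x) '' Ioo 0 (π / 2) = Ioi 0 := by
    ext u
    constructor
    · rintro ⟨x, hx, rfl⟩
      exact mul_pos hb (Real.tan_pos_of_pos_of_lt_pi_div_two hx.1 hx.2)
    · intro hu
      refine ⟨Real.arctan (u / b), ⟨Real.arctan_pos.mpr (div_pos hu hb),
        Real.arctan_lt_pi_div_two _⟩, ?_⟩
      simp only [Real.tan_arctan]
      field_simp
  have hinj : InjOn (fun x => b * Real.tan x) (Ioo 0 (π / 2)) := by
    intro x hx y hy h
    refine Real.tan_inj_of_lt_of_lt_pi_div_two ?_ hx.2 ?_ hy.2 (mul_left_cancel₀ hb.ne' h)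
    · linarith [hx.1, Real.pi_pos]
    · linarith [hy.1, Real.pi_pos]
  have hderiv : ∀ x ∈ Ioo 0 (π / 2), HasDerivWithinAt (fun x => b * Real.tan x)
      (b * (1 / Real.cos x ^ 2)) (Ioo 0 (π / 2)) x := fun x hx =>
    ((Real.hasDerivAt_tan (hcos x hx).ne').const_mul b).hasDerivWithinAt
  rw [← himage, integral_image_eq_integral_abs_deriv_smul measurableSet_Ioo hderiv hinj,
    gaussIntegral, intervalIntegral.integral_of_le (by positivity), integral_Ioc_eq_integral_Ioo]
  refine setIntegral_congr_fun measurableSet_Ioo fun x hx => ?_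
  have hc := hcos x hx
  have hs := Real.sin_sq_add_cos_sq x
  have e : ((b * Real.tan x) ^ 2 + a ^ 2) * ((b * Real.tan x) ^ 2 + b ^ 2) =
      (b / Real.cos x ^ 2) ^ 2 * (a ^ 2 * Real.cos x ^ 2 + b ^ 2 * Real.sin x ^ 2) := by
    rw [Real.tan_eq_sin_div_cos]
    field_simp
    rw [hs]
    ring
  simp only [smul_eq_mul]
  rw [e, Real.sqrt_mul (by positivity), Real.sqrt_sq (by positivity), abs_of_pos (by positivity)]
  field_simp

/-- The substitution `u = (x - ab/x)/2` maps `(0, ∞)` bijectively onto `ℝ` and turns both quadratic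
factors, up to a common square, into `x² + a²` and `x² + b²`. The integrand on `ℝ` is even, which
accounts for the factor two. -/
lemma gaussIntegral_landen {a b : ℝ} (ha : 0 < a) (hb : 0 < b) :
    gaussIntegral ((a + b) / 2) √(a * b) = gaussIntegral a b := by
  have hab : 0 < a * b := mul_pos ha hb
  rw [gaussIntegral_eq_integral_Ioi (Real.sqrt_pos.mpr hab), gaussIntegral_eq_integral_Ioi hb,
    Real.sq_sqrt hab.le]
  set g : ℝ → ℝ := fun u => 1 / √((u ^ 2 + ((a + b) / 2) ^ 2) * (u ^ 2 + a * b)) with hg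
  set f : ℝ → ℝ := fun x => (x - a * b / x) / 2 with hf
  have himage : f '' Ioi 0 = univ := by
    refine eq_univ_of_forall fun u => ?_
    have hlt : |u| < √(u ^ 2 + a * b) := by
      rw [← Real.sqrt_sq_eq_abs]
      exact Real.sqrt_lt_sqrt (sq_nonneg u) (by linarith)
    have hpos : 0 < u + √(u ^ 2 + a * b) := by linarith [neg_abs_le u]
    -- The positive root of `x² - 2ux - ab = 0`.
    refine ⟨u + √(u ^ 2 + a * b), hpos, ?_⟩
    have := Real.sq_sqrt (show 0 ≤ u ^ 2 + a * b by positivity)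
    simp only [hf]
    field_simp
    linear_combination this
  have hinj : InjOn f (Ioi 0) := by
    intro x hx y hy h
    have hx' : 0 < x := hx
    have hy' : 0 < y := hy
    simp only [hf] at h
    field_simp at h
    have h' : (x - y) * (x * y + a * b) = 0 := by linear_combination h
    rcases mul_eq_zero.mp h' with h' | h'
    · linarith
    · have : 0 < x * y + a * b := by positivity
      exact absurd h' this.ne'
  have hderiv : ∀ x ∈ Ioi (0 : ℝ), HasDerivWithinAt f ((1 + a * b / x ^ 2) / 2) (Ioi 0) x := by
    intro x hx
    have hx' : x ≠ 0 := ne_of_gt hx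
    have h1 := ((hasDerivAt_id x).sub ((hasDerivAt_inv hx').const_mul (a * b))).div_const 2
    refine (h1.congr_deriv ?_).hasDerivWithinAt
    field_simp
    ring
  have h1 := integral_image_eq_integral_abs_deriv_smul measurableSet_Ioi hderiv hinj g
  have h2 : ∫ x, g x = 2 * ∫ x in Ioi 0, g x := by
    rw [← integral_comp_abs]
    simp [hg]
  rw [himage, setIntegral_univ, h2] at h1
  have h3 : ∫ x in Ioi (0 : ℝ), |(1 + a * b / x ^ 2) / 2| • g (f x) =
      ∫ x in Ioi (0 : ℝ), 2 * (1 / √((x ^ 2 + a ^ 2) * (x ^ 2 + b ^ 2))) := by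
    refine setIntegral_congr_fun measurableSet_Ioi fun x hx => ?_
    have hx' : 0 < x := hx
    have e : (f x ^ 2 + ((a + b) / 2) ^ 2) * (f x ^ 2 + a * b) =
        ((1 + a * b / x ^ 2) / 4) ^ 2 * ((x ^ 2 + a ^ 2) * (x ^ 2 + b ^ 2)) := by
      simp only [hf]
      field_simp
      ring
    simp only [smul_eq_mul, hg]
    rw [e, Real.sqrt_mul (by positivity), Real.sqrt_sq (by positivity),
      abs_of_pos (by positivity)]
    have : 0 < √((x ^ 2 + a ^ 2) * (x ^ 2 + b ^ 2)) := by positivity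
    field_simp
    norm_num
  rw [h3, integral_const_mul] at h1
  linarith

lemma gaussIntegral_mem_Icc {a b m M : ℝ} (hm : 0 < m) (ha : m ≤ a) (hb : m ≤ b) (ha' : a ≤ M)
    (hb' : b ≤ M) : gaussIntegral a b ∈ Icc (π / 2 * (1 / M)) (π / 2 * (1 / m)) := by
  have hM : 0 < M := by linarith
  have hcs := Real.sin_sq_add_cos_sq
  have h1 : ∀ φ, m ^ 2 ≤ a ^ 2 * Real.cos φ ^ 2 + b ^ 2 * Real.sin φ ^ 2 := fun φ => by
    have := mul_le_mul_of_nonneg_right (pow_le_pow_left₀ hm.le ha 2) (sq_nonneg (Real.cos φ))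
    have := mul_le_mul_of_nonneg_right (pow_le_pow_left₀ hm.le hb 2) (sq_nonneg (Real.sin φ))
    have : m ^ 2 * Real.cos φ ^ 2 + m ^ 2 * Real.sin φ ^ 2 = m ^ 2 := by
      linear_combination m ^ 2 * hcs φ
    linarith
  have h2 : ∀ φ, a ^ 2 * Real.cos φ ^ 2 + b ^ 2 * Real.sin φ ^ 2 ≤ M ^ 2 := fun φ => by
    have := mul_le_mul_of_nonneg_right (pow_le_pow_left₀ (by linarith) ha' 2)
      (sq_nonneg (Real.cos φ))
    have := mul_le_mul_of_nonneg_right (pow_le_pow_left₀ (by linarith) hb' 2)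
      (sq_nonneg (Real.sin φ))
    have : M ^ 2 * Real.cos φ ^ 2 + M ^ 2 * Real.sin φ ^ 2 = M ^ 2 := by
      linear_combination M ^ 2 * hcs φ
    linarith
  have hs : ∀ φ, m ≤ √(a ^ 2 * Real.cos φ ^ 2 + b ^ 2 * Real.sin φ ^ 2) := fun φ =>
    Real.le_sqrt_of_sq_le (h1 φ)
  have hs' : ∀ φ, √(a ^ 2 * Real.cos φ ^ 2 + b ^ 2 * Real.sin φ ^ 2) ≤ M := fun φ =>
    (Real.sqrt_le_left hM.le).mpr (h2 φ)
  have hcont : Continuous fun φ => 1 / √(a ^ 2 * Real.cos φ ^ 2 + b ^ 2 * Real.sin φ ^ 2) :=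
    continuous_const.div (by fun_prop) fun φ => (hm.trans_le (hs φ)).ne'
  have hπ : 0 ≤ π / 2 := by positivity
  have hconst : ∀ c : ℝ, ∫ _ in (0 : ℝ)..(π / 2), c = π / 2 * c := fun c => by simp
  constructor
  · rw [← hconst]
    exact intervalIntegral.integral_mono_on hπ (by simp) (hcont.intervalIntegrable _ _)
      fun φ _ => one_div_le_one_div_of_le (hm.trans_le (hs φ)) (hs' φ)
  · rw [← hconst]
    exact intervalIntegral.integral_mono_on hπ (hcont.intervalIntegrable _ _) (by simp)
      fun φ _ => one_div_le_one_div_of_le hm (hs φ)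

lemma tendsto_gaussIntegral {a b : ℕ → ℝ} (ha : Tendsto a atTop (𝓝 1))
    (hb : Tendsto b atTop (𝓝 1)) :
    Tendsto (fun k => gaussIntegral (a k) (b k)) atTop (𝓝 (π / 2)) := by
  have hmin := ha.min hb
  have hmax := ha.max hb
  rw [min_self] at hmin
  rw [max_self] at hmax
  have hpos : ∀ᶠ k in atTop, 0 < min (a k) (b k) := hmin.eventually (lt_mem_nhds one_pos)
  have h1 := (tendsto_const_nhds (x := π / 2)).mul
    ((tendsto_const_nhds (x := (1 : ℝ))).div hmax one_ne_zero)
  have h2 := (tendsto_const_nhds (x := π / 2)).mul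
    ((tendsto_const_nhds (x := (1 : ℝ))).div hmin one_ne_zero)
  norm_num at h1 h2
  refine tendsto_of_tendsto_of_tendsto_of_le_of_le' h1 h2 ?_ ?_
  · filter_upwards [hpos] with k hk
    simpa using (gaussIntegral_mem_Icc hk (min_le_left _ _) (min_le_right _ _) (le_max_left _ _)
      (le_max_right _ _)).1
  · filter_upwards [hpos] with k hk
    simpa using (gaussIntegral_mem_Icc hk (min_le_left _ _) (min_le_right _ _) (le_max_left _ _)
      (le_max_right _ _)).2

lemma ellipticK_eq_gaussIntegral {a : ℝ} (b : ℝ) (ha : 0 < a) :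
    ellipticK (1 - (b : ℂ) ^ 2 / (a : ℂ) ^ 2) = (a * gaussIntegral a b : ℝ) := by
  rw [gaussIntegral, ← intervalIntegral.integral_const_mul, ← intervalIntegral.integral_ofReal,
    ellipticK]
  refine intervalIntegral.integral_congr fun φ _ => ?_
  have hcs := Real.sin_sq_add_cos_sq φ
  have e : (1 - (1 - b ^ 2 / a ^ 2) * Real.sin φ ^ 2) =
      (a ^ 2 * Real.cos φ ^ 2 + b ^ 2 * Real.sin φ ^ 2) / a ^ 2 := by
    field_simp
    linear_combination a ^ 2 * (-hcs)
  have e' : (1 - (1 - (b : ℂ) ^ 2 / (a : ℂ) ^ 2) * (Real.sin φ : ℂ) ^ 2) =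
      ((a ^ 2 * Real.cos φ ^ 2 + b ^ 2 * Real.sin φ ^ 2) / a ^ 2 : ℝ) := by
    rw [← e]; push_cast; rfl
  have h0 : 0 ≤ (a ^ 2 * Real.cos φ ^ 2 + b ^ 2 * Real.sin φ ^ 2) / a ^ 2 := by positivity
  rw [e', show (1 / 2 : ℂ) = ((1 / 2 : ℝ) : ℂ) by norm_num, ← ofReal_cpow h0, ← Real.sqrt_eq_rpow,
    Real.sqrt_div' _ (by positivity), Real.sqrt_sq ha.le, ← ofReal_one, ← ofReal_div]
  congr 1
  rw [one_div_div, mul_one_div]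

/-! ### Theta constants on the imaginary axis -/

lemma theta3_I_ofReal (y : ℝ) : theta3 0 (I * y) = ((theta3 0 (I * y)).re : ℂ) := by
  refine (conj_eq_iff_re.mp ?_).symm
  simp [theta3, jacobiTheta₂_conj]

lemma theta4_I_ofReal (y : ℝ) : theta4 0 (I * y) = ((theta4 0 (I * y)).re : ℂ) := by
  refine (conj_eq_iff_re.mp ?_).symm
  simp [theta4, jacobiTheta₂_conj, Complex.conj_ofNat]

/-- Doubling `y` replaces `θ₃²` and `θ₄²` by their arithmetic and geometric means, which leaves the
integral unchanged. Both tend to `1` under iteration, and the integral at `(1, 1)` is `π/2`. -/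
lemma gaussIntegral_theta {y : ℝ} (hy : 0 < y) :
    gaussIntegral ((theta3 0 (I * y)).re ^ 2) ((theta4 0 (I * y)).re ^ 2) = π / 2 := by
  have him : ∀ {y : ℝ}, 0 < y → 0 < (I * y).im := fun h => by simpa using h
  have hne3 : ∀ {y : ℝ}, 0 < y → (theta3 0 (I * y)).re ≠ 0 := fun {y} h h0 => by
    have := theta3_zero_ne (him h)
    rw [theta3_I_ofReal, h0] at this
    simp at this
  have hne4 : ∀ {y : ℝ}, 0 < y → (theta4 0 (I * y)).re ≠ 0 := fun {y} h h0 => by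
    have := theta4_zero_ne (him h)
    rw [theta4_I_ofReal, h0] at this
    simp at this
  have step : ∀ {y : ℝ}, 0 < y → gaussIntegral ((theta3 0 (I * (2 * y : ℝ))).re ^ 2)
      ((theta4 0 (I * (2 * y : ℝ))).re ^ 2) =
      gaussIntegral ((theta3 0 (I * y)).re ^ 2) ((theta4 0 (I * y)).re ^ 2) := by
    intro y hy
    have h3 := hne3 hy
    have h4 := hne4 hy
    have e : 2 * (I * (y : ℂ)) = I * (2 * y : ℝ) := by push_cast; ring
    have d3 := theta3_sq_add_theta4_sq (him hy)
    have d4 := theta3_mul_theta4_zero (him hy)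
    rw [e, theta3_I_ofReal y, theta4_I_ofReal y, theta3_I_ofReal (2 * y)] at d3
    rw [e, theta3_I_ofReal y, theta4_I_ofReal y, theta4_I_ofReal (2 * y)] at d4
    norm_cast at d3 d4
    rw [← gaussIntegral_landen (a := (theta3 0 (I * y)).re ^ 2) (b := (theta4 0 (I * y)).re ^ 2)
      (by positivity) (by positivity), d3, ← mul_pow, d4,
      Real.sqrt_sq (by positivity)]
    push_cast
    congr 1
    ring
  have iter : ∀ k : ℕ, gaussIntegral ((theta3 0 (2 ^ k * (I * y))).re ^ 2)
      ((theta4 0 (2 ^ k * (I * y))).re ^ 2) =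
      gaussIntegral ((theta3 0 (I * y)).re ^ 2) ((theta4 0 (I * y)).re ^ 2) := by
    intro k
    induction k with
    | zero => simp
    | succ k ih =>
      have h := step (y := 2 ^ k * y) (by positivity)
      rw [show I * ((2 * (2 ^ k * y) : ℝ) : ℂ) = 2 ^ (k + 1) * (I * y) by push_cast; ring,
        show I * ((2 ^ k * y : ℝ) : ℂ) = 2 ^ k * (I * y) by push_cast; ring] at h
      rw [h, ih]
  have hlim := tendsto_two_pow_mul (him hy)
  have l3 := ((continuous_re.tendsto _).comp (tendsto_theta3.comp hlim)).pow 2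
  have l4 := ((continuous_re.tendsto _).comp (tendsto_theta4.comp hlim)).pow 2
  simp only [one_re, one_pow] at l3 l4
  exact tendsto_nhds_unique (tendsto_const_nhds.congr fun k => (iter k).symm)
    (tendsto_gaussIntegral l3 l4)

lemma cpow_half_sq (z : ℂ) : (z ^ (1 / 2 : ℂ)) ^ 2 = z := by
  rw [← cpow_nat_mul]; norm_num

lemma theta3_sq_I_inv {y : ℝ} (hy : 0 < y) :
    theta3 0 (I * (y⁻¹ : ℝ)) ^ 2 = y * theta3 0 (I * y) ^ 2 := by
  have hy' : (y : ℂ) ≠ 0 := by exact_mod_cast hy.ne'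
  have h := jacobiTheta₂_functional_equation 0 (I * y)
  have e1 : -I * (I * (y : ℂ)) = y := by linear_combination (-(y : ℂ)) * I_sq
  have e2 : -1 / (I * (y : ℂ)) = I * (y⁻¹ : ℝ) := by
    push_cast; field_simp; simp
  have e3 := cpow_half_sq y
  rw [e1, e2] at h
  simp only [theta3]
  norm_num at h e3 ⊢
  rw [h, mul_pow, inv_pow, e3]
  field_simp

/-- The inversion `τ ↦ -1/τ` at the half period `z = τ/2`, which it sends to `1/2`, so that `θ₂`
becomes `θ₄`. Squaring removes the root of `y`. -/
lemma theta2_sq_I {y : ℝ} (hy : 0 < y) :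
    y * theta2 0 (I * y) ^ 2 = theta4 0 (I * (y⁻¹ : ℝ)) ^ 2 := by
  have hy' : (y : ℂ) ≠ 0 := by exact_mod_cast hy.ne'
  have h := jacobiTheta₂_functional_equation (I * y / 2) (I * y)
  have e1 : -I * (I * (y : ℂ)) = y := by linear_combination (-(y : ℂ)) * I_sq
  have e2 : -1 / (I * (y : ℂ)) = I * (y⁻¹ : ℝ) := by
    push_cast; field_simp; simp
  have e3 := cpow_half_sq y
  have e4 : I * (y : ℂ) / 2 / (I * y) = 1 / 2 := by field_simp
  have e5 : -π * I * (I * y / 2) ^ 2 / (I * y) = -(I * π * (I * y) / 4) := by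
    field_simp; norm_num
  rw [e1, e2, e4, e5] at h
  simp only [theta2, theta4, zero_div, zero_add, mul_zero, add_zero, h]
  rw [show ∀ a b c d : ℂ, y * (a * (1 / b * c * d)) ^ 2 = y / b ^ 2 * (a * c) ^ 2 * d ^ 2 by
    intros; ring, e3, ← Complex.exp_add, add_neg_cancel, Complex.exp_zero, div_self hy']
  ring

/-- The parameter `t = 1 - θ₄⁴/θ₃⁴` attached to `τ = iy`. -/
noncomputable def modulusI (y : ℝ) : ℝ :=
  1 - ((theta4 0 (I * y)).re / (theta3 0 (I * y)).re) ^ 4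

lemma ofReal_modulusI (y : ℝ) :
    (modulusI y : ℂ) = 1 - (theta4 0 (I * y) / theta3 0 (I * y)) ^ 4 := by
  rw [theta4_I_ofReal, theta3_I_ofReal, modulusI]
  push_cast
  simp

section ImaginaryAxis

variable {y : ℝ} (hy : 0 < y)
include hy

lemma ellipticK_modulusI : ellipticK (modulusI y) = π / 2 * theta3 0 (I * y) ^ 2 := by
  have h3 : (theta3 0 (I * y)).re ≠ 0 := fun h0 => by
    have := theta3_zero_ne (τ := I * y) (by simpa using hy)
    rw [theta3_I_ofReal, h0] at this
    simp at this
  have h := ellipticK_eq_gaussIntegral ((theta4 0 (I * y)).re ^ 2)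
    (a := (theta3 0 (I * y)).re ^ 2) (by positivity)
  rw [gaussIntegral_theta hy] at h
  rw [theta3_I_ofReal, modulusI]
  push_cast at h ⊢
  rw [mul_comm (π / 2 : ℂ), ← h]
  congr 1
  ring

lemma modulusI_eq : (modulusI y : ℂ) = (theta2 0 (I * y) / theta3 0 (I * y)) ^ 4 := by
  have him : 0 < (I * (y : ℂ)).im := by simpa using hy
  have h3 := theta3_zero_ne him
  rw [ofReal_modulusI]
  field_simp
  linear_combination -theta_quartic him

lemma one_sub_modulusI : 1 - modulusI y = modulusI y⁻¹ := by
  have him : 0 < (I * (y : ℂ)).im := by simpa using hy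
  have hy' : (y : ℂ) ≠ 0 := by exact_mod_cast hy.ne'
  have h3 := theta3_zero_ne him
  have hy1 : 0 < y⁻¹ := by positivity
  have h := theta2_sq_I hy1
  rw [inv_inv] at h
  have : ((1 - modulusI y : ℝ) : ℂ) = (modulusI y⁻¹ : ℝ) := by
    rw [ofReal_sub, ofReal_one, ofReal_modulusI, modulusI_eq hy1]
    rw [show ∀ a b : ℂ, (a / b) ^ 4 = (a ^ 2 / b ^ 2) ^ 2 by intros; ring,
      show ∀ a b : ℂ, (a / b) ^ 4 = (a ^ 2 / b ^ 2) ^ 2 by intros; ring, ← h, theta3_sq_I_inv hy]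
    push_cast
    field_simp
    ring
  exact_mod_cast this

/-- Inversion exchanges `t` and `1 - t`, so `K'` is `(π/2) θ₃(0|i/y)² = y K`. -/
lemma tau_modulusI : tau (modulusI y) = I * y := by
  have h3 := theta3_zero_ne (τ := I * y) (by simpa using hy)
  have hπ := pi_ne_zero'
  rw [tau, ← ofReal_one, ← ofReal_sub, one_sub_modulusI hy, ellipticK_modulusI hy,
    ellipticK_modulusI (inv_pos.mpr hy), theta3_sq_I_inv hy]
  field_simp

lemma modulusI_lt_one : modulusI y < 1 := by
  have h3 : (theta3 0 (I * y)).re ≠ 0 := fun h0 => by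
    have := theta3_zero_ne (τ := I * y) (by simpa using hy)
    rw [theta3_I_ofReal, h0] at this
    simp at this
  have h4 : (theta4 0 (I * y)).re ≠ 0 := fun h0 => by
    have := theta4_zero_ne (τ := I * y) (by simpa using hy)
    rw [theta4_I_ofReal, h0] at this
    simp at this
  rw [modulusI, sub_lt_self_iff]
  positivity

lemma modulusI_pos : 0 < modulusI y := by
  have h := modulusI_lt_one (inv_pos.mpr hy)
  rw [← one_sub_modulusI hy] at h
  linarith

end ImaginaryAxis

/-! ### The complete elliptic integral in the complex domain -/

lemma one_sub_mul_mem_slitPlane {t : ℂ} (ht : 1 - t ∈ slitPlane) {s : ℝ} (h0 : 0 ≤ s)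
    (h1 : s ≤ 1) : 1 - t * s ∈ slitPlane := by
  have := starConvex_one_slitPlane ht (sub_nonneg.mpr h1) h0 (by ring)
  simp only [real_smul, ofReal_sub, ofReal_one] at this
  convert this using 1
  ring

lemma one_sub_mul_sin_sq_mem_slitPlane {t : ℂ} (ht : 1 - t ∈ slitPlane) (φ : ℝ) :
    1 - t * (Real.sin φ : ℂ) ^ 2 ∈ slitPlane := by
  have := one_sub_mul_mem_slitPlane ht (sq_nonneg (Real.sin φ)) (Real.sin_sq_le_one φ)
  rwa [ofReal_pow] at this

lemma continuous_ellipticK_integrand {t : ℂ} (ht : 1 - t ∈ slitPlane) :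
    Continuous fun φ : ℝ => 1 / (1 - t * (Real.sin φ : ℂ) ^ 2) ^ (1 / 2 : ℂ) := by
  refine continuous_const.div (Continuous.cpow (by fun_prop) continuous_const
    (one_sub_mul_sin_sq_mem_slitPlane ht)) fun φ h => ?_
  rw [cpow_eq_zero_iff] at h
  exact slitPlane_ne_zero (one_sub_mul_sin_sq_mem_slitPlane ht φ) h.1

lemma differentiableAt_ellipticK {t : ℂ} (ht : 1 - t ∈ slitPlane) :
    DifferentiableAt ℂ ellipticK t := by
  have hopen : IsOpen {t : ℂ | 1 - t ∈ slitPlane} :=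
    isOpen_slitPlane.preimage (continuous_const.sub continuous_id)
  obtain ⟨ε, hε, hball⟩ := Metric.nhds_basis_closedBall.mem_iff.mp (hopen.mem_nhds ht)
  set F' : ℂ → ℝ → ℂ := fun x φ => -(1 / 2 * (1 - x * (Real.sin φ : ℂ) ^ 2) ^ (1 / 2 - 1 : ℂ) *
    -(Real.sin φ : ℂ) ^ 2) / ((1 - x * (Real.sin φ : ℂ) ^ 2) ^ (1 / 2 : ℂ)) ^ 2 with hF'
  have hne : ∀ {x : ℂ}, 1 - x ∈ slitPlane → ∀ φ : ℝ,
      (1 - x * (Real.sin φ : ℂ) ^ 2) ^ (1 / 2 : ℂ) ≠ 0 := fun hx φ h => by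
    rw [cpow_eq_zero_iff] at h
    exact slitPlane_ne_zero (one_sub_mul_sin_sq_mem_slitPlane hx φ) h.1
  have hcont : ContinuousOn (fun p : ℂ × ℝ => F' p.1 p.2)
      (Metric.closedBall t ε ×ˢ Icc 0 (π / 2)) := by
    have hb : ContinuousOn (fun p : ℂ × ℝ => 1 - p.1 * (Real.sin p.2 : ℂ) ^ 2)
      (Metric.closedBall t ε ×ˢ Icc 0 (π / 2)) := by fun_prop
    have hs : ∀ p ∈ Metric.closedBall t ε ×ˢ Icc 0 (π / 2),
        1 - p.1 * (Real.sin p.2 : ℂ) ^ 2 ∈ slitPlane := fun p hp =>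
      one_sub_mul_sin_sq_mem_slitPlane (hball hp.1) p.2
    refine ContinuousOn.div ((((continuousOn_const.mul (hb.cpow continuousOn_const hs)).mul
      (by fun_prop))).neg) ((hb.cpow continuousOn_const hs).pow 2) fun p hp => ?_
    exact pow_ne_zero 2 (hne (hball hp.1) p.2)
  -- The derivative of the integrand is jointly continuous on a compact set, so one constant
  -- dominates it.
  obtain ⟨C, hC⟩ := ((isCompact_closedBall t ε).prod isCompact_Icc).exists_bound_of_continuousOn
    hcont
  have hsub : ∀ φ ∈ uIoc 0 (π / 2), φ ∈ Icc 0 (π / 2) := fun φ hφ => by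
    rw [uIoc_of_le (by positivity)] at hφ
    exact Ioc_subset_Icc_self hφ
  have hcontF' : ContinuousOn (F' t) (Icc 0 (π / 2)) :=
    hcont.comp (f := fun φ => (t, φ)) (by fun_prop) fun φ hφ =>
      ⟨Metric.mem_closedBall_self hε.le, hφ⟩
  refine (intervalIntegral.hasDerivAt_integral_of_dominated_loc_of_deriv_le (F' := F')
    (bound := fun _ => C) (Metric.closedBall_mem_nhds t hε) ?_
    ((continuous_ellipticK_integrand ht).intervalIntegrable _ _) ?_ ?_ (by simp)
    ?_).2.differentiableAt
  · filter_upwards [hopen.mem_nhds ht] with x hx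
    exact (continuous_ellipticK_integrand hx).aestronglyMeasurable
  · refine (hcontF'.mono fun φ hφ => hsub φ hφ).aestronglyMeasurable measurableSet_uIoc
  · exact Eventually.of_forall fun φ hφ x hx => hC (x, φ) ⟨hx, hsub φ hφ⟩
  · refine Eventually.of_forall fun φ hφ x hx => ?_
    have h1 : HasDerivAt (fun x : ℂ => 1 - x * (Real.sin φ : ℂ) ^ 2) (-(Real.sin φ : ℂ) ^ 2) x := by
      simpa using ((hasDerivAt_id x).mul_const ((Real.sin φ : ℂ) ^ 2)).const_sub 1
    have h2 := (h1.cpow_const (c := 1 / 2)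
      (one_sub_mul_sin_sq_mem_slitPlane (hball hx) φ)).inv (hne (hball hx) φ)
    exact h2.congr_of_eventuallyEq (Eventually.of_forall fun x => one_div _)

lemma re_integral_mul_pos {f : ℝ → ℂ} (hf : Continuous f) {c : ℂ}
    (h : ∀ φ ∈ Ioo 0 (π / 2), 0 < (f φ * c).re) :
    0 < ((∫ φ in (0 : ℝ)..(π / 2), f φ) * c).re := by
  rw [← intervalIntegral.integral_mul_const]
  have hc : Continuous fun φ => f φ * c := hf.mul continuous_const
  have := reCLM.intervalIntegral_comp_comm (hc.intervalIntegrable 0 (π / 2) (μ := volume))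
  simp only [reCLM_apply] at this
  rw [← this]
  exact intervalIntegral.intervalIntegral_pos_of_pos_on
    ((continuous_re.comp hc).intervalIntegrable _ _) h (by positivity)

lemma cpow_half_re_pos {z : ℂ} (hz : z ∈ slitPlane) : 0 < (z ^ (1 / 2 : ℂ)).re := by
  rw [show (1 / 2 : ℂ) = ((1 / 2 : ℝ) : ℂ) by norm_num, cpow_ofReal_re]
  have h0 := slitPlane_ne_zero hz
  have h1 := neg_pi_lt_arg z
  have h2 := lt_of_le_of_ne (arg_le_pi z) (mem_slitPlane_iff_arg.mp hz).1
  refine mul_pos (Real.rpow_pos_of_pos (norm_pos_iff.mpr h0) _)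
    (Real.cos_pos_of_mem_Ioo ⟨?_, ?_⟩) <;> linarith

lemma one_div_re_pos {w : ℂ} (hw : 0 < w.re) : 0 < (1 / w).re := by
  rw [one_div, inv_re]
  refine div_pos hw (normSq_pos.mpr ?_)
  rintro rfl
  simp at hw

lemma sin_sq_mem_Ioo {φ : ℝ} (h : φ ∈ Ioo 0 (π / 2)) : Real.sin φ ^ 2 ∈ Ioo 0 1 := by
  have h1 := Real.sin_pos_of_pos_of_lt_pi h.1 (by linarith [h.2, Real.pi_pos])
  have h2 := Real.cos_pos_of_mem_Ioo ⟨by linarith [h.1, Real.pi_pos], h.2⟩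
  refine ⟨by positivity, ?_⟩
  nlinarith [Real.sin_sq_add_cos_sq φ]

lemma ellipticK_re_pos {t : ℂ} (ht : 1 - t ∈ slitPlane) : 0 < (ellipticK t).re := by
  have := re_integral_mul_pos (continuous_ellipticK_integrand ht) (c := 1) fun φ _ => by
    rw [mul_one]
    exact one_div_re_pos (cpow_half_re_pos (one_sub_mul_sin_sq_mem_slitPlane ht φ))
  rwa [mul_one] at this

lemma ellipticK_ne_zero {t : ℂ} (ht : 1 - t ∈ slitPlane) : ellipticK t ≠ 0 := fun h => by
  have := ellipticK_re_pos ht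
  simp [h] at this

/-- If two points lie in complementary closed half-planes, and the angle between them is less
than `π`, then the angle between their principal square roots is less than `π / 2`. -/
lemma re_mul_conj_pos_of_sq {a b : ℂ} {s s' t₁ t₂ : ℝ} (ha : 0 < a.re) (hb : 0 < b.re)
    (hs : s ∈ Ioo 0 1) (hs' : s' ∈ Ioo 0 1)
    (ha2 : a ^ 2 = 1 - (1 - ⟨t₁, t₂⟩) * (s : ℂ)) (hb2 : b ^ 2 = 1 - ⟨t₁, t₂⟩ * (s' : ℂ)) :
    0 < (a * conj b).re := by
  have e1 := congrArg Complex.im ha2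
  have e2 := congrArg Complex.re ha2
  have e3 := congrArg Complex.im hb2
  have e4 := congrArg Complex.re hb2
  simp [pow_two] at e1 e2 e3 e4
  simp only [mul_re, conj_re, conj_im, mul_neg, sub_neg_eq_add]
  by_contra! hneg
  have hr : a.im * b.im < 0 := by nlinarith [mul_pos ha hb]
  have hk : 0 < s + s' - s * s' := by nlinarith [hs.1, hs.2, hs'.1, hs'.2]
  -- Imaginary part of `(a * conj b)² = a² * conj (b²)`. Here `Im a` has the sign of `t₂` and `Im b`
  -- the opposite one, so the second factor on the left has the sign of `t₂`, and the assumption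
  -- that the first is nonpositive contradicts this identity.
  have key : 2 * (a.re * b.re + a.im * b.im) * (a.im * b.re - a.re * b.im) =
      t₂ * (s + s' - s * s') := by
    have : 2 * (a.re * b.re + a.im * b.im) * (a.im * b.re - a.re * b.im) =
        (a.re * a.im + a.im * a.re) * (b.re * b.re - b.im * b.im) -
        (a.re * a.re - a.im * a.im) * (b.re * b.im + b.im * b.re) := by ring
    rw [this, e1, e2, e3, e4]
    ring
  rcases lt_trichotomy t₂ 0 with h | h | h
  · have ha' : a.im < 0 := by
      by_contra! h'
      nlinarith [mul_nonneg ha.le h', mul_neg_of_neg_of_pos h hs.1]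
    have hb' : 0 < b.im := by
      by_contra! h'
      nlinarith [mul_nonneg_of_nonpos_of_nonpos ha'.le h']
    have hw : a.im * b.re - a.re * b.im ≤ 0 := by
      nlinarith [mul_neg_of_neg_of_pos ha' hb, mul_pos ha hb']
    nlinarith [mul_nonneg_of_nonpos_of_nonpos hneg hw, mul_neg_of_neg_of_pos h hk]
  · rw [h] at e1
    have : a.im * a.re = 0 := by linarith
    rcases mul_eq_zero.mp this with h' | h'
    · rw [h'] at hr; simp at hr
    · linarith
  · have ha' : 0 < a.im := by
      by_contra! h'
      nlinarith [mul_nonpos_of_nonneg_of_nonpos ha.le h', mul_pos h hs.1]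
    have hb' : b.im < 0 := by
      by_contra! h'
      nlinarith [mul_nonneg ha'.le h']
    have hw : 0 ≤ a.im * b.re - a.re * b.im := by
      nlinarith [mul_pos ha' hb, mul_neg_of_pos_of_neg ha hb']
    nlinarith [mul_nonneg hw (sub_nonneg.mpr hneg), mul_pos h hk]

/-- Taking one integral at a time reduces the claim to the product of one integrand with the
conjugate of the other, whose real part is positive at every interior pair of angles. -/
lemma ellipticK_mul_conj_re_pos {t : ℂ} (ht : t ∈ cutPlane) :
    0 < (ellipticK (1 - t) * conj (ellipticK t)).re := by
  have ht' : 1 - (1 - t) ∈ slitPlane := by rw [sub_sub_cancel]; exact ht.1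
  refine re_integral_mul_pos (continuous_ellipticK_integrand ht') fun φ hφ => ?_
  rw [show ∀ u v : ℂ, (u * conj v).re = (v * conj u).re by intros; simp; ring]
  refine re_integral_mul_pos (continuous_ellipticK_integrand ht.2) fun ψ hψ => ?_
  have ha := cpow_half_re_pos (one_sub_mul_sin_sq_mem_slitPlane ht' φ)
  have hb := cpow_half_re_pos (one_sub_mul_sin_sq_mem_slitPlane ht.2 ψ)
  have := re_mul_conj_pos_of_sq (t₁ := t.re) (t₂ := t.im) ha hb (sin_sq_mem_Ioo hφ)
    (sin_sq_mem_Ioo hψ) (by rw [cpow_half_sq, ofReal_pow]) (by rw [cpow_half_sq, ofReal_pow])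
  have h := one_div_re_pos this
  convert h using 1
  rw [show ∀ u v : ℂ, (u * conj v).re = (v * conj u).re by intros; simp; ring, map_div₀, map_one,
    div_mul_div_comm, one_mul]

lemma tau_im_pos {t : ℂ} (ht : t ∈ cutPlane) : 0 < (tau t).im := by
  have h := ellipticK_mul_conj_re_pos ht
  have h0 := ellipticK_ne_zero ht.2
  rw [tau, mul_div_assoc, I_mul_im, div_eq_mul_inv, inv_def, ← mul_assoc, re_mul_ofReal]
  exact mul_pos h (inv_pos.mpr (normSq_pos.mpr h0))

lemma differentiableAt_tau {t : ℂ} (ht : t ∈ cutPlane) : DifferentiableAt ℂ tau t := by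
  have h1 : DifferentiableAt ℂ ellipticK (1 - t) :=
    differentiableAt_ellipticK (by rw [sub_sub_cancel]; exact ht.1)
  have h2 : DifferentiableAt ℂ (fun t : ℂ => ellipticK (1 - t)) t :=
    h1.comp t ((differentiableAt_const 1).sub differentiableAt_id)
  exact ((differentiableAt_const I).mul h2).div (differentiableAt_ellipticK ht.2)
    (ellipticK_ne_zero ht.2)

/-! ### From the imaginary axis to the cut plane -/

lemma isOpen_cutPlane : IsOpen cutPlane :=
  isOpen_slitPlane.inter (isOpen_slitPlane.preimage (continuous_const.sub continuous_id))

lemma isPreconnected_cutPlane : IsPreconnected cutPlane := by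
  have h1 : StarConvex ℝ ((1 / 2 : ℝ) : ℂ) slitPlane :=
    starConvex_ofReal_slitPlane (by norm_num)
  have h2 : StarConvex ℝ ((1 / 2 : ℝ) : ℂ) cutPlane := by
    intro z hz a b ha hb hab
    refine ⟨h1 hz.1 ha hb hab, ?_⟩
    have := h1 hz.2 ha hb hab
    convert this using 1
    have hab' : (a : ℂ) + b = 1 := by exact_mod_cast hab
    simp only [real_smul]
    push_cast
    linear_combination (-1 : ℂ) * hab'
  have hmem : ((1 / 2 : ℝ) : ℂ) ∈ cutPlane := by
    constructor <;> simp only [mem_slitPlane_iff] <;> left <;> norm_num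
  exact (h2.isPathConnected hmem).isConnected.isPreconnected

lemma differentiableAt_theta_tau {t : ℂ} (ht : t ∈ cutPlane) :
    DifferentiableAt ℂ (fun t => theta2 0 (tau t)) t ∧
      DifferentiableAt ℂ (fun t => theta3 0 (tau t)) t := by
  have h := (differentiableAt_tau ht).hasDerivAt
  have h0 := hasDerivAt_const t (0 : ℂ)
  exact ⟨(hasDerivAt_theta2_path (tau_im_pos ht) h0 h).differentiableAt,
    (hasDerivAt_theta3_path (tau_im_pos ht) h0 h).differentiableAt⟩

lemma modulusI_mem_cutPlane {y : ℝ} (hy : 0 < y) : (modulusI y : ℂ) ∈ cutPlane := by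
  have h1 := modulusI_pos hy
  have h2 := modulusI_lt_one hy
  constructor <;> rw [mem_slitPlane_iff] <;> left
  · simpa using h1
  · simpa using h2

/-- Two holomorphic functions on the cut plane that agree on the image of the imaginary axis
are equal. -/
lemma eqOn_cutPlane {f g : ℂ → ℂ} (hf : DifferentiableOn ℂ f cutPlane)
    (hg : DifferentiableOn ℂ g cutPlane)
    (h : ∀ y : ℝ, 0 < y → f (modulusI y) = g (modulusI y)) : EqOn f g cutPlane := by
  refine (hf.analyticOnNhd isOpen_cutPlane).eqOn_of_preconnected_of_frequently_eq
    (hg.analyticOnNhd isOpen_cutPlane) isPreconnected_cutPlane (modulusI_mem_cutPlane one_pos) ?_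
  have him : 0 < (I * ((1 : ℝ) : ℂ)).im := by simp
  have hc3 : ContinuousAt (theta3 0) (I * ((1 : ℝ) : ℂ)) :=
    (hasDerivAt_theta3_path (ξ := fun _ => 0) (T := fun s => s) him (hasDerivAt_const _ _)
      (hasDerivAt_id _)).continuousAt
  have hc4 : ContinuousAt (theta4 0) (I * ((1 : ℝ) : ℂ)) :=
    (hasDerivAt_theta4_path (ξ := fun _ => 0) (T := fun s => s) him (hasDerivAt_const _ _)
      (hasDerivAt_id _)).continuousAt
  have hI : ContinuousAt (fun y : ℝ => I * (y : ℂ)) 1 := by fun_prop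
  have hcont : ContinuousAt (fun y : ℝ => (modulusI y : ℂ)) 1 := by
    simp_rw [ofReal_modulusI]
    exact continuousAt_const.sub (((hc4.comp (f := fun y : ℝ => I * (y : ℂ)) hI).div
      (hc3.comp (f := fun y : ℝ => I * (y : ℂ)) hI) (theta3_zero_ne him)).pow 4)
  have hpos : ∀ᶠ y : ℝ in 𝓝[≠] 1, 0 < y :=
    eventually_nhdsWithin_of_eventually_nhds (lt_mem_nhds one_pos)
  have htend : Tendsto (fun y : ℝ => (modulusI y : ℂ)) (𝓝[≠] 1) (𝓝[≠] (modulusI 1 : ℂ)) := by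
    -- `tau` is a left inverse of `modulusI` up to the factor `I`, so the points `modulusI y` avoid
    -- `modulusI 1` for `y ≠ 1` and do accumulate there.
    refine tendsto_nhdsWithin_iff.mpr ⟨hcont.mono_left nhdsWithin_le_nhds, ?_⟩
    filter_upwards [hpos, self_mem_nhdsWithin] with y hy hne heq
    have e := tau_modulusI hy
    rw [show (modulusI y : ℂ) = modulusI 1 from heq, tau_modulusI one_pos] at e
    have := mul_left_cancel₀ I_ne_zero e
    exact hne (by exact_mod_cast this.symm)
  exact htend.frequently ((hpos.mono fun y hy => h y hy).frequently)

theorem mul_theta3_tau {t : ℂ} (ht : t ∈ cutPlane) :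
    t * theta3 0 (tau t) ^ 4 = theta2 0 (tau t) ^ 4 := by
  refine eqOn_cutPlane (f := fun t => t * theta3 0 (tau t) ^ 4)
    (g := fun t => theta2 0 (tau t) ^ 4) (fun t ht => ?_) (fun t ht => ?_) (fun y hy => ?_) ht
  · exact (differentiableAt_id.mul ((differentiableAt_theta_tau ht).2.pow 4)).differentiableWithinAt
  · exact ((differentiableAt_theta_tau ht).1.pow 4).differentiableWithinAt
  · have h3 := theta3_zero_ne (τ := I * y) (by simpa using hy)
    rw [tau_modulusI hy, modulusI_eq hy]
    field_simp

theorem ellipticK_eq {t : ℂ} (ht : t ∈ cutPlane) :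
    ellipticK t = π / 2 * theta3 0 (tau t) ^ 2 := by
  refine eqOn_cutPlane (f := ellipticK) (g := fun t => π / 2 * theta3 0 (tau t) ^ 2)
    (fun t ht => ?_) (fun t ht => ?_) (fun y hy => ?_) ht
  · exact (differentiableAt_ellipticK ht.2).differentiableWithinAt
  · exact ((differentiableAt_theta_tau ht).2.pow 2).const_mul _ |>.differentiableWithinAt
  · rw [tau_modulusI hy, ellipticK_modulusI hy]

/-- Logarithmic differentiation of `t = θ₂⁴/θ₃⁴` with the heat equation gives `1/t = -iπ τ' (θ₂''/θ₂
- θ₃''/θ₃)`, and the bracket is the Wronskian value `-θ₄⁴`. -/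
theorem exists_hasDerivAt_tau {t : ℂ} (ht : t ∈ cutPlane) : ∃ τ', HasDerivAt tau τ' t ∧
    I * π * τ' * theta2 0 (tau t) ^ 4 * theta4 0 (tau t) ^ 4 = theta3 0 (tau t) ^ 4 := by
  have h := (differentiableAt_tau ht).hasDerivAt
  refine ⟨_, h, ?_⟩
  have him := tau_im_pos ht
  have h0 := hasDerivAt_const t (0 : ℂ)
  have d2 := hasDerivAt_theta2_path him h0 h
  have d3 := hasDerivAt_theta3_path him h0 h
  have hl := (hasDerivAt_id t).mul (d3.pow 4)
  have := hl.unique ((d2.pow 4).congr_of_eventuallyEq (by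
    filter_upwards [isOpen_cutPlane.mem_nhds ht] with s hs
    simpa using mul_theta3_tau hs))
  have h3 := theta3_zero_ne him
  have w := theta2dd_zero_wronskian him
  have e := mul_theta3_tau ht
  simp at this
  apply mul_left_cancel₀ h3
  set T := deriv tau t
  linear_combination -theta3 0 (tau t) * this - (theta3dd 0 (tau t)) * I * π * T * e +
    I * π * T * theta2 0 (tau t) ^ 3 * w

/-! ### The Picard solution in terms of theta functions -/

section CutPlane

variable {t : ℂ} (ht : t ∈ cutPlane)
include ht

lemma thetaArg_zVar (x y : ℂ) : thetaArg (zVar x y t) t = x + tau t * y := by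
  have h := ellipticK_ne_zero ht.2
  have hπ := pi_ne_zero'
  rw [thetaArg, zVar]
  field_simp

lemma ne_zero_of_mem_cutPlane : t ≠ 0 := slitPlane_ne_zero ht.1

lemma sub_one_ne_zero_of_mem_cutPlane : t - 1 ≠ 0 := fun h =>
  slitPlane_ne_zero ht.2 (by linear_combination -h)

lemma sub_one_mul_theta3_tau : (t - 1) * theta3 0 (tau t) ^ 4 = -theta4 0 (tau t) ^ 4 := by
  linear_combination mul_theta3_tau ht + theta_quartic (tau_im_pos ht)

lemma cn_sq_div_sn_sq {x y : ℂ} (h4 : theta4 (x + tau t * y) (tau t) ≠ 0) :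
    cn (zVar x y t) t ^ 2 / sn (zVar x y t) t ^ 2 =
      theta4 0 (tau t) ^ 2 * theta2 (x + tau t * y) (tau t) ^ 2 /
        (theta3 0 (tau t) ^ 2 * theta1 (x + tau t * y) (tau t) ^ 2) := by
  have h2 := theta2_zero_ne (tau_im_pos ht)
  rw [cn, sn, thetaArg_zVar ht]
  field_simp

lemma picardQ_eq {x y : ℂ} (h4 : theta4 (x + tau t * y) (tau t) ≠ 0) :
    picardQ x y t = theta2 0 (tau t) ^ 2 * theta2 (x + tau t * y) (tau t) ^ 2 /
      (theta3 0 (tau t) ^ 2 * theta3 (x + tau t * y) (tau t) ^ 2) := by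
  have a2 := theta2_zero_ne (tau_im_pos ht)
  have a3 := theta3_zero_ne (tau_im_pos ht)
  have a4 := theta4_zero_ne (tau_im_pos ht)
  have e := eq_div_of_mul_eq (pow_ne_zero 4 a3) (mul_theta3_tau ht)
  rw [picardQ, cn, dn, thetaArg_zVar ht]
  generalize tau t = τ at *
  rw [e]
  -- At a zero of `θ₃` both sides are `0` by the convention for division by zero.
  by_cases h3 : theta3 (x + τ * y) τ = 0
  · simp [h3]
  · field_simp

lemma scrE_eq (x y : ℂ) : theta3 0 (tau t) ^ 2 * scrE x y t =
    theta1d (x + tau t * y) (tau t) / theta1 (x + tau t * y) (tau t) + 2 * I * y / π := by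
  have a3 := theta3_zero_ne (tau_im_pos ht)
  have hπ := pi_ne_zero'
  rw [scrE, logDeriv_apply, (hasDerivAt_theta1 _ (tau_im_pos ht)).deriv, ellipticK_eq ht]
  field_simp

omit ht in
lemma hasDerivAt_tau_arg {τ' : ℂ} (h : HasDerivAt tau τ' t) (x y : ℂ) :
    HasDerivAt (fun s => x + tau s * y) (τ' * y) t :=
  (h.mul_const y).const_add x

lemma deriv_tau_mul {τ' : ℂ}
    (h : I * π * τ' * theta2 0 (tau t) ^ 4 * theta4 0 (tau t) ^ 4 = theta3 0 (tau t) ^ 4) :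
    1 / (t * (t - 1)) = -(I * π * τ') * theta3 0 (tau t) ^ 4 := by
  have a3 := theta3_zero_ne (tau_im_pos ht)
  have h0 := ne_zero_of_mem_cutPlane ht
  have h1 := sub_one_ne_zero_of_mem_cutPlane ht
  have e1 := mul_theta3_tau ht
  have e2 := sub_one_mul_theta3_tau ht
  rw [div_eq_iff (mul_ne_zero h0 h1)]
  apply mul_left_cancel₀ (pow_ne_zero 4 a3)
  linear_combination -h + I * π * τ' * theta4 0 (tau t) ^ 4 * (-e1) +
    I * π * τ' * t * theta3 0 (tau t) ^ 4 * e2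

end CutPlane

/-! ### The logarithmic derivative of `tauFn` -/

theorem hasDerivAt_tauFn {x y t : ℂ} (ht : t ∈ regularSet x y) :
    HasDerivAt (tauFn x y) (picardH0 x y t * tauFn x y t) t := by
  obtain ⟨hc, b1, b4⟩ := ht
  have him := tau_im_pos hc
  have a2 := theta2_zero_ne him
  have a3 := theta3_zero_ne him
  have a4 := theta4_zero_ne him
  have hπ := pi_ne_zero'
  have h0 := ne_zero_of_mem_cutPlane hc
  have h1 := sub_one_ne_zero_of_mem_cutPlane hc
  obtain ⟨τ', hτ, hτ'⟩ := exists_hasDerivAt_tau hc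
  have hw := deriv_tau_mul hc hτ'
  have hE := scrE_eq hc x y
  have hcs := cn_sq_div_sn_sq hc b4
  have quad := theta_quadratic_cn him (x + tau t * y)
  have hld := theta1_log_deriv2 him (x + tau t * y)
  rw [theta1d_zero him] at hld
  have d1 := hasDerivAt_theta1_path him (hasDerivAt_tau_arg hτ x y) hτ
  have d4 := hasDerivAt_theta4_path him (hasDerivAt_const t (0 : ℂ)) hτ
  have dp := (hasDerivAt_id t).cpow_const (c := -(1 / 4)) hc.1
  have de := ((hτ.const_mul (I * π)).mul_const (y ^ 2 / (π : ℂ) ^ 2)).cexp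
  have key := (de.mul dp).mul (d1.div d4 a4)
  refine key.congr_deriv ?_
  have hpow : (id t : ℂ) ^ (-(1 / 4) - 1 : ℂ) = t ^ (-(1 / 4) : ℂ) / t := by
    rw [id, cpow_sub _ _ h0, cpow_one]
  have hH : picardH0 x y t = I * π * τ' * (y ^ 2 / π ^ 2) - 1 / (4 * t) +
      (theta1d (x + tau t * y) (tau t) * (τ' * y) +
        -(I * π / 4) * theta1dd (x + tau t * y) (tau t) * τ') / theta1 (x + tau t * y) (tau t) -
      (-(I * π / 4) * theta4dd 0 (tau t) * τ') / theta4 0 (tau t) := by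
    set P := I * π * τ' with hP
    have hτP : τ' = -I * P / π := by
      rw [hP]; field_simp; linear_combination τ' * I_sq
    set L := theta1d (x + tau t * y) (tau t) / theta1 (x + tau t * y) (tau t) with hL
    set w := 1 / (t * (t - 1)) with hwdef
    -- The addition formula in logarithmic form; its `θ₄''/θ₄` cancels against the derivative of the
    -- denominator `θ₄(0|τ)`.
    have r1 : theta1dd (x + tau t * y) (tau t) / theta1 (x + tau t * y) (tau t) =
        L ^ 2 + theta4dd 0 (tau t) / theta4 0 (tau t) - theta2 0 (tau t) ^ 2 * theta3 0 (tau t) ^ 2 *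
          theta4 (x + tau t * y) (tau t) ^ 2 / theta1 (x + tau t * y) (tau t) ^ 2 := by
      rw [hL]
      field_simp
      apply mul_left_cancel₀ a4
      linear_combination hld
    have r2 : theta3 0 (tau t) ^ 4 * (cn (zVar x y t) t ^ 2 / sn (zVar x y t) t ^ 2 + 1) =
        theta2 0 (tau t) ^ 2 * theta3 0 (tau t) ^ 2 *
          theta4 (x + tau t * y) (tau t) ^ 2 / theta1 (x + tau t * y) (tau t) ^ 2 := by
      rw [hcs]
      field_simp
      linear_combination quad
    have r3 : picardH0 x y t = -(t * w / 4) -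
        w / 4 * (cn (zVar x y t) t ^ 2 / sn (zVar x y t) t ^ 2) + w / 4 * scrE x y t ^ 2 := by
      have : ∀ a b : ℂ, a / (4 * t * (t - 1) * b) = w / 4 * (a / b) := fun a b => by
        rw [hwdef, div_div, div_mul_div_comm, one_mul]; congr 1; ring
      rw [picardH0, this, hwdef]
      field_simp
    have r4 : 1 / (4 * t) = (t - 1) * w / 4 := by rw [hwdef]; field_simp
    -- The completed square: `L²` comes from the heat equation, the cross term from the motion of `x
    -- + τy`, and the `y²` term from the exponential prefactor.
    have r5 : w * scrE x y t ^ 2 = -P * (L + 2 * I * y / π) ^ 2 := by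
      rw [← hE, hw]; ring
    have r6 : (theta1d (x + tau t * y) (tau t) * (τ' * y) +
        -(I * π / 4) * theta1dd (x + tau t * y) (tau t) * τ') / theta1 (x + tau t * y) (tau t) =
        L * (-I * P / π * y) -
          P / 4 * (theta1dd (x + tau t * y) (tau t) / theta1 (x + tau t * y) (tau t)) := by
      rw [← hτP, hL, hP]; ring
    have r7 : (-(I * π / 4) * theta4dd 0 (tau t) * τ') / theta4 0 (tau t) =
        -P / 4 * (theta4dd 0 (tau t) / theta4 0 (tau t)) := by
      rw [hP]; ring
    rw [r3, r4, r6, r7, r1, ← r2]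
    linear_combination r5 / 4 -
      (1 + cn (zVar x y t) t ^ 2 / sn (zVar x y t) t ^ 2) / 4 * hw - P * y ^ 2 / π ^ 2 * I_sq
  rw [hH, hpow, tauFn]
  simp only [Pi.mul_apply, Pi.div_apply, id]
  field_simp
  ring

lemma tauFn_ne_zero {x y t : ℂ} (ht : t ∈ regularSet x y) : tauFn x y t ≠ 0 := by
  have a4 := theta4_zero_ne (tau_im_pos ht.1)
  refine mul_ne_zero (mul_ne_zero (Complex.exp_ne_zero _) ?_) (div_ne_zero ht.2.1 a4)
  rw [Ne, cpow_eq_zero_iff]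
  exact fun h => ne_zero_of_mem_cutPlane ht.1 h.1

lemma isOpen_regularSet (x y : ℂ) : IsOpen (regularSet x y) := by
  refine isOpen_iff_mem_nhds.mpr fun t ht => ?_
  obtain ⟨hc, b1, b4⟩ := ht
  have him := tau_im_pos hc
  have hτ := (differentiableAt_tau hc).hasDerivAt
  have d1 := hasDerivAt_theta1_path him (hasDerivAt_tau_arg hτ x y) hτ
  have d4 := hasDerivAt_theta4_path him (hasDerivAt_tau_arg hτ x y) hτ
  filter_upwards [isOpen_cutPlane.mem_nhds hc, d1.continuousAt.eventually_ne b1,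
    d4.continuousAt.eventually_ne b4] with s h h1 h4
  exact ⟨h, h1, h4⟩

/-- Near a zero-free point, a logarithm of a solution of `T' = h T` is an antiderivative of `h`. -/
lemma exists_local_antiderivative {T h : ℂ → ℂ} {t : ℂ} (h0 : T t ≠ 0)
    (hT : ∀ᶠ s in 𝓝 t, HasDerivAt T (h s * T s) s) :
    ∃ F : ℂ → ℂ, ∀ᶠ s in 𝓝 t, HasDerivAt F (h s) s := by
  have hcont : ContinuousAt (fun s => T s / T t) t := hT.self_of_nhds.continuousAt.div_const _
  have hmem : T t / T t ∈ slitPlane := by rw [div_self h0]; exact one_mem_slitPlane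
  refine ⟨fun s => log (T s / T t), ?_⟩
  filter_upwards [hT, hcont.eventually (isOpen_slitPlane.mem_nhds hmem),
    hT.self_of_nhds.continuousAt.eventually_ne h0] with s hs hs1 hs0
  refine ((hs.div_const (T t)).clog hs1).congr_deriv ?_
  field_simp

lemma exists_exp_eq_const_mul {T h F : ℂ → ℂ} {U : Set ℂ} (hU : IsOpen U)
    (hUc : IsPreconnected U) (h0 : ∀ t ∈ U, T t ≠ 0)
    (hT : ∀ t ∈ U, HasDerivAt T (h t * T t) t) (hF : ∀ t ∈ U, HasDerivAt F (h t) t) :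
    ∃ c : ℂ, c ≠ 0 ∧ ∀ t ∈ U, cexp (F t) = c * T t := by
  rcases U.eq_empty_or_nonempty with rfl | ⟨t₀, ht₀⟩
  · exact ⟨1, one_ne_zero, by simp⟩
  have hd : ∀ t ∈ U, HasDerivAt (fun t => cexp (F t) / T t) 0 t := fun t ht => by
    refine ((hF t ht).cexp.div (hT t ht) (h0 t ht)).congr_deriv ?_
    rw [div_eq_zero_iff]
    left
    ring
  obtain ⟨c, hc⟩ := hU.exists_is_const_of_deriv_eq_zero hUc
    (fun t ht => (hd t ht).differentiableAt.differentiableWithinAt) fun t ht => (hd t ht).deriv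
  refine ⟨c, ?_, fun t ht => ?_⟩
  · rw [← hc t₀ ht₀]
    exact div_ne_zero (Complex.exp_ne_zero _) (h0 t₀ ht₀)
  · rw [← hc t ht, div_mul_cancel₀ _ (h0 t ht)]

/-! ### The Hamiltonian along the Picard solution -/

lemma picardHam_eq (t q p : ℂ) : picardHam t q p =
    1 / (t * (t - 1)) * (q * (q - 1) * (q - t) * p ^ 2 + q * (q - 1) * p + (q - t) / 4) := by
  simp only [picardHam, hamiltonianVI]
  ring

lemma deriv_picardHam (t q p : ℂ) : deriv (fun s => picardHam t q s) p =
    1 / (t * (t - 1)) * (2 * (q * (q - 1) * (q - t)) * p + q * (q - 1)) := by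
  simp_rw [picardHam_eq]
  have h := (((((hasDerivAt_id p).pow 2).const_mul (q * (q - 1) * (q - t))).add
    ((hasDerivAt_id p).const_mul (q * (q - 1)))).add_const ((q - t) / 4)).const_mul
      (1 / (t * (t - 1)))
  refine HasDerivAt.deriv (h.congr_deriv ?_)
  simp only [id]
  push_cast
  ring

/-- In the logarithmic derivative of `θ₂²Θ₂²/(θ₃²Θ₃²)` every term is a multiple of `D = Θ₂'/Θ₂ -
Θ₃'/Θ₃`, and the cofactor of `D` collects to `Θ₁'/Θ₁ + 2iy/π`, which is `θ₃² 𝓔`. -/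
lemma hasDerivAt_picardQ {x y t : ℂ} (ht : t ∈ genericSet x y) {τ' : ℂ}
    (hτ : HasDerivAt tau τ' t) :
    HasDerivAt (picardQ x y) (picardQ x y t * (I * π * τ' *
      (theta3 0 (tau t) ^ 2 * scrE x y t) * theta4 0 (tau t) ^ 2 *
        (theta1 (x + tau t * y) (tau t) * theta4 (x + tau t * y) (tau t)) /
        (theta2 (x + tau t * y) (tau t) * theta3 (x + tau t * y) (tau t)))) t := by
  obtain ⟨hr, b2, b3⟩ := ht
  have hr' := hr
  obtain ⟨hc, b1, b4⟩ := hr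
  have him := tau_im_pos hc
  have a2 := theta2_zero_ne him
  have a3 := theta3_zero_ne him
  have hπ := pi_ne_zero'
  have hξ := hasDerivAt_tau_arg hτ x y
  have hz := hasDerivAt_const t (0 : ℂ)
  have dA2 := hasDerivAt_theta2_path him hz hτ
  have dA3 := hasDerivAt_theta3_path him hz hτ
  have dB2 := hasDerivAt_theta2_path him hξ hτ
  have dB3 := hasDerivAt_theta3_path him hξ hτ
  have key := ((dA2.pow 2).mul (dB2.pow 2)).div ((dA3.pow 2).mul (dB3.pow 2))
    (mul_ne_zero (pow_ne_zero 2 a3) (pow_ne_zero 2 b3))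
  have key' := key.congr_of_eventuallyEq (f₁ := picardQ x y) (by
    filter_upwards [(isOpen_regularSet x y).mem_nhds hr'] with s hs
    exact picardQ_eq hs.1 hs.2.2)
  refine key'.congr_deriv ?_
  rw [picardQ_eq hc b4, scrE_eq hc x y]
  have w0 := theta2dd_zero_wronskian him
  obtain ⟨w1, w2⟩ := theta1_theta4_wronskian him (x + tau t * y)
  have w3 : theta2dd (x + tau t * y) (tau t) * theta3 (x + tau t * y) (tau t) -
      theta2 (x + tau t * y) (tau t) * theta3dd (x + tau t * y) (tau t) =
      -theta4 0 (tau t) ^ 2 * (theta1d (x + tau t * y) (tau t) * theta4 (x + tau t * y) (tau t) +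
        theta1 (x + tau t * y) (tau t) * theta4d (x + tau t * y) (tau t)) := by
    have hl := ((hasDerivAt_theta2d (x + tau t * y) him).mul
      (hasDerivAt_theta3 (x + tau t * y) him)).sub
      ((hasDerivAt_theta2 (x + tau t * y) him).mul (hasDerivAt_theta3d (x + tau t * y) him))
    have hr := ((hasDerivAt_theta1 (x + tau t * y) him).mul
      (hasDerivAt_theta4 (x + tau t * y) him)).const_mul (-theta4 0 (tau t) ^ 2)
    have := hl.unique (hr.congr_of_eventuallyEq (Eventually.of_forall fun z => by
      simpa using (theta1_theta4_wronskian him z).2))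
    linear_combination this
  simp only [Pi.mul_apply, Pi.pow_apply]
  generalize theta2dd (x + tau t * y) (tau t) = B2dd at *
  generalize theta3dd (x + tau t * y) (tau t) = B3dd at *
  generalize theta1d (x + tau t * y) (tau t) = B1d at *
  generalize theta2d (x + tau t * y) (tau t) = B2d at *
  generalize theta3d (x + tau t * y) (tau t) = B3d at *
  generalize theta4d (x + tau t * y) (tau t) = B4d at *
  generalize theta1 (x + tau t * y) (tau t) = B1 at *
  generalize theta2 (x + tau t * y) (tau t) = B2 at *
  generalize theta3 (x + tau t * y) (tau t) = B3 at *
  generalize theta4 (x + tau t * y) (tau t) = B4 at *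
  generalize theta2 0 (tau t) = A2 at *
  generalize theta3 0 (tau t) = A3 at *
  generalize theta4 0 (tau t) = A4 at *
  generalize theta2dd 0 (tau t) = A2dd at *
  generalize theta3dd 0 (tau t) = A3dd at *
  have u0 : A2dd / A2 - A3dd / A3 = -A4 ^ 4 := by
    rw [div_sub_div _ _ a2 a3, div_eq_iff (mul_ne_zero a2 a3), w0]
  have u1 : B1d / B1 - B4d / B4 = A4 ^ 2 * (B2 * B3) / (B1 * B4) := by
    rw [div_sub_div _ _ b1 b4, w1]
  have u2 : B2d / B2 - B3d / B3 = -A4 ^ 2 * (B1 * B4) / (B2 * B3) := by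
    rw [div_sub_div _ _ b2 b3, w2]
  have u3 : B2dd / B2 - B3dd / B3 = (B2d / B2 - B3d / B3) * (B1d / B1 + B4d / B4) := by
    rw [div_sub_div _ _ b2 b3, w3, u2]
    field_simp
  -- The two Wronskians multiply to a constant, the same one as in `u0`. So the theta constants
  -- contribute `D (Θ₁'/Θ₁ - Θ₄'/Θ₄)`, which added to `u3` leaves `2D Θ₁'/Θ₁`.
  have u4 : (B2d / B2 - B3d / B3) * (B1d / B1 - B4d / B4) = -A4 ^ 4 := by
    rw [u1, u2]
    field_simp
  have e : A4 ^ 2 * (B1 * B4) / (B2 * B3) = -(B2d / B2 - B3d / B3) := by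
    rw [u2]; ring
  have hI : τ' * 2 * y = -(I * π * τ' * (2 * I * y / π)) := by
    field_simp
    linear_combination τ' * y * I_sq
  trans A2 ^ 2 * B2 ^ 2 / (A3 ^ 2 * B3 ^ 2) * (2 * (-(I * π / 4) * τ' * (A2dd / A2 - A3dd / A3) +
    τ' * y * (B2d / B2 - B3d / B3) - (I * π / 4) * τ' * (B2dd / B2 - B3dd / B3)))
  · field_simp
    ring
  · congr 1
    rw [show ∀ a : ℂ, a * A4 ^ 2 * (B1 * B4) / (B2 * B3) = a * (A4 ^ 2 * (B1 * B4) / (B2 * B3)) by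
      intro a; ring, e, u3, u0]
    linear_combination (B2d / B2 - B3d / B3) * hI + I * π * τ' / 2 * u4

theorem picard_hamiltonian {x y t : ℂ} (ht : t ∈ genericSet x y) : ∃ p : ℂ,
    (∀ p' : ℂ, HasDerivAt (picardQ x y)
      (deriv (fun s => picardHam t (picardQ x y t) s) p') t ↔ p' = p) ∧
    picardHam t (picardQ x y t) p = picardH0 x y t := by
  obtain ⟨⟨hc, b1, b4⟩, b2, b3⟩ := id ht
  have him := tau_im_pos hc
  have a2 := theta2_zero_ne him
  have a3 := theta3_zero_ne him
  have a4 := theta4_zero_ne him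
  have h0 := ne_zero_of_mem_cutPlane hc
  have h1 := sub_one_ne_zero_of_mem_cutPlane hc
  obtain ⟨τ', hτ, hτ'⟩ := exists_hasDerivAt_tau hc
  have hw := deriv_tau_mul hc hτ'
  have hd := hasDerivAt_picardQ ht hτ
  have hq := picardQ_eq hc b4 (x := x) (y := y)
  have hcs := cn_sq_div_sn_sq hc b4 (x := x) (y := y)
  have quad1 := theta_quadratic_cn him (x + tau t * y)
  have quad2 := theta_quadratic_dn him (x + tau t * y)
  have quart := theta_quartic him
  have e1 := mul_theta3_tau hc
  have e2 := sub_one_mul_theta3_tau hc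
  have hH : picardH0 x y t = 1 / (t * (t - 1)) * ((-t -
      cn (zVar x y t) t ^ 2 / sn (zVar x y t) t ^ 2 + scrE x y t ^ 2) / 4) := by
    have : ∀ a b : ℂ, a / (4 * t * (t - 1) * b) = 1 / (t * (t - 1)) * (a / b / 4) := fun a b => by
      rw [div_div, div_mul_div_comm, one_mul]; congr 1; ring
    rw [picardH0, this]
    field_simp
  rw [hcs] at hH
  set τ := tau t
  set E := scrE x y t
  set q := picardQ x y t
  generalize theta1 (x + τ * y) τ = B1 at *
  generalize theta2 (x + τ * y) τ = B2 at *
  generalize theta3 (x + τ * y) τ = B3 at *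
  generalize theta4 (x + τ * y) τ = B4 at *
  generalize theta2 0 τ = A2 at *
  generalize theta3 0 τ = A3 at *
  generalize theta4 0 τ = A4 at *
  -- The two quadratic relations and Jacobi's quartic identity combine to give the numerators of `q
  -- - 1` and, in `s2`, of `q - t`.
  have s1 : A2 ^ 2 * B2 ^ 2 - A3 ^ 2 * B3 ^ 2 = -(A4 ^ 2 * B4 ^ 2) := by
    apply mul_left_cancel₀ (pow_ne_zero 2 a4)
    linear_combination A2 ^ 2 * quad1 - A3 ^ 2 * quad2 + B4 ^ 2 * quart
  have s2 : A3 ^ 2 * B2 ^ 2 - A2 ^ 2 * B3 ^ 2 = -(A4 ^ 2 * B1 ^ 2) := by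
    apply mul_left_cancel₀ (pow_ne_zero 2 a4)
    linear_combination A3 ^ 2 * quad1 - A2 ^ 2 * quad2 + B1 ^ 2 * quart
  have ht' : t = A2 ^ 4 / A3 ^ 4 := eq_div_of_mul_eq (pow_ne_zero 4 a3) e1
  have hq1 : q - 1 = -(A4 ^ 2 * B4 ^ 2) / (A3 ^ 2 * B3 ^ 2) := by
    rw [hq, ← s1]; field_simp
  have hqt : q - t = -(A2 ^ 2 * A4 ^ 2 * B1 ^ 2) / (A3 ^ 4 * B3 ^ 2) := by
    rw [hq, ht']
    field_simp
    linear_combination s2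
  have q0 : q ≠ 0 := by rw [hq]; simp [a2, a3, b2, b3]
  have q1 : q - 1 ≠ 0 := by rw [hq1]; simp [a3, a4, b4, b3]
  have qt : q - t ≠ 0 := by rw [hqt]; simp [a2, a3, a4, b1, b3]
  set G := q * (q - 1) * (q - t) with hG
  have G0 : G ≠ 0 := mul_ne_zero (mul_ne_zero q0 q1) qt
  set q' := q * (I * π * τ' * (A3 ^ 2 * E) * A4 ^ 2 * (B1 * B4) / (B2 * B3)) with hq'
  have hN : t * (t - 1) * q' = -(A2 ^ 2 * A4 ^ 2 * E * B1 * B2 * B4) / (A3 ^ 4 * B3 ^ 3) := by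
    have hP : I * π * τ' = -(1 / (t * (t - 1))) / A3 ^ 4 := by
      rw [hw]; field_simp
    rw [hq', hP, hq]
    field_simp
  -- The sign of the momentum's square-root part is lost here: in `H` only the square of `t(t-1)q'`
  -- survives.
  have hN2 : (t * (t - 1) * q') ^ 2 = E ^ 2 * G := by
    rw [hN, hG, hq1, hqt, hq]
    field_simp
  -- This says `q(t - 1) = (cn²/sn²)(q - t)`, so that `q(q-1)/(q-t) = q + cn²/sn²`, which brings the
  -- `cn²/sn²` term of `H₀` into the Hamiltonian.
  have hcq : q * (1 - t) = -(A4 ^ 2 * B2 ^ 2 / (A3 ^ 2 * B1 ^ 2)) * (q - t) := by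
    rw [hqt, hq, show 1 - t = A4 ^ 4 / A3 ^ 4 from
      eq_div_of_mul_eq (pow_ne_zero 4 a3) (by linear_combination -e2)]
    field_simp
  -- Solution of `t(t-1)q' = 2Gp + q(q-1)`. Substituting it completes the square in `p` and leaves
  -- `((t(t-1)q')² - (q(q-1))²)/(4G)`.
  refine ⟨(t * (t - 1) * q' - q * (q - 1)) / (2 * G), fun p' => ?_, ?_⟩
  · rw [deriv_picardHam]
    constructor
    · intro h
      have := h.unique hd
      rw [← this, ← hG]
      field_simp
      ring
    · rintro rfl
      refine hd.congr_deriv ?_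
      rw [← hG]
      field_simp
      ring
  · rw [picardHam_eq, hH, ← hG]
    congr 1
    have : G * ((t * (t - 1) * q' - q * (q - 1)) / (2 * G)) ^ 2 +
        q * (q - 1) * ((t * (t - 1) * q' - q * (q - 1)) / (2 * G)) =
        ((t * (t - 1) * q') ^ 2 - (q * (q - 1)) ^ 2) / (4 * G) := by
      field_simp
      ring
    rw [this, hN2]
    have hGd : (q * (q - 1)) ^ 2 / (4 * G) = q * (q - 1) / (4 * (q - t)) := by
      rw [hG]; field_simp
    have hGE : E ^ 2 * G / (4 * G) = E ^ 2 / 4 := by field_simp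
    have hGq : q * (q - 1) / (4 * (q - t)) = (q + A4 ^ 2 * B2 ^ 2 / (A3 ^ 2 * B1 ^ 2)) / 4 := by
      rw [div_eq_iff (mul_ne_zero (by norm_num : (4 : ℂ) ≠ 0) qt)]
      linear_combination -hcq
    rw [sub_div, hGd, hGE, hGq]
    ring

end PicardPVI

theorem theorem1 (x y : ℂ) :
    -- along the Picard solution the momentum `p` is determined by `dq/dt = ∂H/∂p`, and the
    -- Hamiltonian there is `H₀`
    (∀ t ∈ PicardPVI.genericSet x y, ∃ p : ℂ,
      (∀ p' : ℂ, HasDerivAt (PicardPVI.picardQ x y)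
        (deriv (fun s => PicardPVI.picardHam t (PicardPVI.picardQ x y t) s) p') t ↔ p' = p) ∧
      PicardPVI.picardHam t (PicardPVI.picardQ x y t) p = PicardPVI.picardH0 x y t) ∧
    -- `H₀ = d/dt log T₀`
    (∀ t ∈ PicardPVI.regularSet x y, PicardPVI.tauFn x y t ≠ 0 ∧
      HasDerivAt (PicardPVI.tauFn x y)
        (PicardPVI.picardH0 x y t * PicardPVI.tauFn x y t) t) ∧
    -- `H₀` has antiderivatives locally
    (∀ t ∈ PicardPVI.regularSet x y, ∃ F : ℂ → ℂ,
      ∀ᶠ s in nhds t, HasDerivAt F (PicardPVI.picardH0 x y s) s) ∧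
    -- `exp ∫ H₀ dt = c₀ T₀` for every antiderivative on a connected open set
    (∀ U : Set ℂ, IsOpen U → IsPreconnected U → U ⊆ PicardPVI.regularSet x y →
      ∀ F : ℂ → ℂ, (∀ t ∈ U, HasDerivAt F (PicardPVI.picardH0 x y t) t) →
        ∃ c₀ : ℂ, c₀ ≠ 0 ∧ ∀ t ∈ U, Complex.exp (F t) = c₀ * PicardPVI.tauFn x y t) := by
  open PicardPVI in
  exact ⟨fun t ht => picard_hamiltonian ht,
    fun t ht => ⟨tauFn_ne_zero ht, hasDerivAt_tauFn ht⟩,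
    fun t ht => exists_local_antiderivative (tauFn_ne_zero ht) (by
      filter_upwards [(isOpen_regularSet x y).mem_nhds ht] with s hs
      exact hasDerivAt_tauFn hs),
    fun U hU hUc hsub F hF => exists_exp_eq_const_mul hU hUc
      (fun t ht => tauFn_ne_zero (hsub ht)) (fun t ht => hasDerivAt_tauFn (hsub ht)) hF⟩
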